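/- \textbf{Conventions.} Let $\mathbf\Delta$ be the category with objects the finite totally ordered sets $\underline n=\{1,\dots,n\}$, $n\ge 0$, and morphisms the totally ordered (weakly monotone) maps; $(\underline n\downarrow\mathbf\Delta)$ is the category of objects of $\mathbf\Delta$ under $\underline n$. For a directed graph $G$ let $\mathrm{Fr}(G)$ be the free bicategory on $G$, whose 1-cells are parenthesized composable words in edges of $G$ and formal units. The \emph{free lax functor} on $G$ is $L_G\colon \mathrm{Fr}(G)\to \mathrm{Fr}_{\mathrm{lax}}(G)$, where $\mathrm{Fr}_{\mathrm{lax}}(G)$ is the bicategory whose 0-cells are the vertices of $G$, whose 1-cells are parenthesized composable words in formal units and symbols $L_G(W)$ ($W$ a 1-cell of $\mathrm{Fr}(G)$), and whose 2-cells are generated under vertical composition and whiskering by associators, unitors, the 2-cells $L_G(\eta)$ ($\eta$ a 2-cell of $\mathrm{Fr}(G)$), unit maps $i\colon I_A\to L_G(I_A)$ and composition maps $m\colon L_G(W)\odot L_G(W')\to L_G(W\odot W')$, subject to the axioms of a bicategory and of a lax functor. The free oplax functor $\mathrm{Fr}(G)\to\mathrm{Fr}_{\mathrm{oplax}}(G)$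 is defined in the same way, with $i$ and $m$ pointing in the other direction and the axioms of an oplax functor. \textbf{Supporting maps.} A 1-cell $x$ of $\mathrm{Fr}_{\mathrm{lax}}(G)$ with $n$ occurrences of edges and $k$ symbols $L_G(\cdot)$ is assigned the map $U(x)\colon\underline n\to\underline k$ that sends $\ell$ to $j$ if the $\ell$-th edge lies in the $j$-th symbol. A 2-cell $\phi$ of $\mathrm{Fr}_{\mathrm{lax}}(G)$ is assigned the totally ordered map $U(\phi)$ between the sets of symbols of its source and target for which associators, unitors and 2-cells $L_G(\eta)$ act as identities, whiskered unit maps as the corresponding coface maps, and whiskered composition maps as the corresponding codegeneracy maps. For each 1-cell $W\colon A\to B$ with $n$ edges this gives the supporting set functor $$U\colon \mathrm{Fr}_{\mathrm{lax}}(G)(A,B)_{[W]}\longrightarrow(\underline n\downarrow\mathbf\Delta)$$ on the connected component of $W$. In the oplax case $U(\phi)$ goes in the direction opposite to $\phi$, and $U$ takes values in $(\underline n\downarrow\mathbf\Delta)^{\mathrm{op}}$. \textbf{Formal diagrams.} Let $F\colon\mathcal C\to\mathcal D$ be a lax functor of bicategories and $|\mathcal C|$ the graph of 0-cells and 1-cells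 of $\mathcal C$. There is an induced strict functor $\mathrm{Fr}_{\mathrm{lax}}(|\mathcal C|)\to\mathcal D$, which sends $L_{|\mathcal C|}(W)$ to $F$ of the composite of $W$ in $\mathcal C$ and $i$, $m$ to the structure maps of $F$. A diagram of 2-cells in $\mathcal D(F(A),F(B))$ is \emph{formal} if it lifts along this functor to $\mathrm{Fr}_{\mathrm{lax}}(|\mathcal C|)(A,B)$, and it is \emph{expected to commute} if it has a lift in which any two parallel composites $\phi,\psi$ satisfy $U(\phi)=U(\psi)$. The definitions for an oplax functor use $\mathrm{Fr}_{\mathrm{oplax}}(|\mathcal C|)$. For a lax (oplax) monoidal functor, the definitions are those for the associated lax (oplax) functor of bicategories with one 0-cell. \textbf{Theorem (Coherence for lax functors).} \begin{enumerate} \item For every lax functor of bicategories, every formal diagram that is expected to commute commutes. \item For every lax monoidal functor, every formal diagram that is expected to commute commutes. \item For every directed graph $G$, all vertices $A,B$ and every 1-cell $W\colon A\to B$ of $\mathrm{Fr}_{\mathrm{lax}}(G)$ with $n$ edges, the supporting set functor $U\colon \mathrm{Fr}_{\mathrm{lax}}(G)(A,B)_{[W]}\to(\underline n\downarrow\mathbf\Delta)$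 is an equivalence of categories. \item The statements (1)--(3) also hold for oplax functors, oplax monoidal functors and $\mathrm{Fr}_{\mathrm{oplax}}(G)$, with $(\underline n\downarrow\mathbf\Delta)$ replaced by $(\underline n\downarrow\mathbf\Delta)^{\mathrm{op}}$. \end{enumerate} -/

import Mathlib

open CategoryTheory Bicategory

universe w w' w₁ w₂ v v₁ v₂ u u₁ u₂

namespace LaxCoherence

theorem eq_eqToHom_comp {A : Type*} [Category* A] {x y : A} (f : x ⟶ y) :
    f = eqToHom rfl ≫ f := by
  simp

theorem eq_eqToHom_comp_comp {A : Type*} [Category* A] {x y : A} (f : x ⟶ y) :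
    f = eqToHom rfl ≫ f ≫ eqToHom rfl := by
  simp

theorem eq_inv_comp_of_retraction {A : Type*} [Category* A] {x y z t : A} (e : x ≅ y)
    (r : x ⟶ z) (c : z ⟶ t) (s : t ⟶ y) (s' : y ⟶ t) (h : s ≫ s' = 𝟙 t)
    (h' : r ≫ c ≫ s = e.hom) : s' = e.inv ≫ r ≫ c := by
  rw [Iso.eq_inv_comp, ← h', Category.assoc, Category.assoc, h, Category.comp_id]

/-! ### Finite totally ordered sets and totally ordered maps -/

/-- The category `Δ`: a skeleton of the category of finite, possibly empty, totally ordered sets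
and totally ordered maps. The object `n` stands for the ordered set with `n` elements. -/
structure Delta : Type where
  /-- The number of elements. -/
  card : ℕ

instance : Category Delta where
  Hom m n := Fin m.card →o Fin n.card
  id _ := OrderHom.id
  comp f g := g.comp f

/-- The order isomorphism between `Fin m` and `Fin n` for equal `m` and `n`. -/
def castHom {m n : ℕ} (h : m = n) : Fin m →o Fin n where
  toFun := Fin.cast h
  monotone' _ _ hij := hij

/-- Two totally ordered maps side by side (ordinal sum). -/
def sumHom {m k n l : ℕ} (f : Fin m →o Fin k) (g : Fin n →o Fin l) :
    Fin (m + n) →o Fin (k + l) where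
  toFun := Fin.addCases (fun i => Fin.castAdd l (f i)) (fun j => Fin.natAdd k (g j))
  monotone' := by
    intro x y
    refine Fin.addCases (fun i => ?_) (fun i => ?_) x <;>
      refine Fin.addCases (fun j => ?_) (fun j => ?_) y <;> intro h
    · simp only [Fin.addCases_left]
      exact f.monotone h
    · simp only [Fin.addCases_left, Fin.addCases_right, Fin.le_def, Fin.val_castAdd, Fin.val_natAdd]
      have := (f i).2
      omega
    · simp only [Fin.le_def, Fin.val_castAdd, Fin.val_natAdd] at h
      have := j.2
      omega
    · simp only [Fin.addCases_right, Fin.le_def, Fin.val_natAdd] at h ⊢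
      have : i ≤ j := by
        rw [Fin.le_def]; omega
      have := Fin.le_def.1 (g.monotone this)
      omega

theorem castHom_val {m n : ℕ} (h : m = n) (i : Fin m) : (castHom h i : ℕ) = i := rfl

theorem sumHom_val {m k n l : ℕ} (f : Fin m →o Fin k) (g : Fin n →o Fin l) (i : Fin (m + n)) :
    (sumHom f g i : ℕ) =
      if h : (i : ℕ) < m then (f ⟨i, h⟩ : ℕ) else k + g ⟨i - m, by omega⟩ := by
  refine Fin.addCases (fun j => ?_) (fun j => ?_) i
  · have h : ((Fin.castAdd n j : Fin (m + n)) : ℕ) < m := j.2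
    rw [dif_pos h]
    change ((Fin.addCases _ _ (Fin.castAdd n j) : Fin (k + l)) : ℕ) = _
    rw [Fin.addCases_left]
    rfl
  · have h : ¬ ((Fin.natAdd m j : Fin (m + n)) : ℕ) < m := by simp
    rw [dif_neg h]
    change ((Fin.addCases _ _ (Fin.natAdd m j) : Fin (k + l)) : ℕ) = _
    rw [Fin.addCases_right]
    simp

theorem sumHom_id (m n : ℕ) :
    sumHom (OrderHom.id : Fin m →o Fin m) (OrderHom.id : Fin n →o Fin n) = OrderHom.id := by
  ext i
  rw [sumHom_val]
  split_ifs <;> simp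
  omega

theorem sumHom_comp {m m' m'' n n' n'' : ℕ} (f : Fin m →o Fin m') (f' : Fin m' →o Fin m'')
    (g : Fin n →o Fin n') (g' : Fin n' →o Fin n'') :
    sumHom (f'.comp f) (g'.comp g) = (sumHom f' g').comp (sumHom f g) := by
  ext i
  simp only [OrderHom.comp_coe, Function.comp_apply, sumHom_val]
  split_ifs with h h' h'
  · rfl
  · exact absurd (f ⟨i, h⟩).2 h'
  · omega
  · simp


section SumHom

variable {m m' k k' n n' p q : ℕ}

theorem sumHom_empty_left (f : Fin m →o Fin k) :
    sumHom (OrderHom.id : Fin 0 →o Fin 0) f =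
      ((castHom (Nat.zero_add k).symm).comp f).comp (castHom (Nat.zero_add m)) := by
  ext i
  simp only [OrderHom.comp_coe, Function.comp_apply, castHom_val, sumHom_val]
  rw [dif_neg (Nat.not_lt_zero _), Nat.zero_add]
  rfl

theorem sumHom_empty_right (f : Fin m →o Fin k) :
    sumHom f (OrderHom.id : Fin 0 →o Fin 0) =
      ((castHom (Nat.add_zero k).symm).comp f).comp (castHom (Nat.add_zero m)) := by
  ext i
  simp only [OrderHom.comp_coe, Function.comp_apply, castHom_val, sumHom_val]
  rw [dif_pos (show (i : ℕ) < m from i.2)]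
  rfl

theorem sumHom_assoc (f : Fin m →o Fin m') (g : Fin n →o Fin n') (h : Fin k →o Fin k') :
    (castHom (Nat.add_assoc m' n' k')).comp (sumHom (sumHom f g) h) =
      (sumHom f (sumHom g h)).comp (castHom (Nat.add_assoc m n k)) := by
  ext i
  simp only [OrderHom.comp_coe, Function.comp_apply, castHom_val, sumHom_val]
  split_ifs <;> first | rfl | omega | skip
  simp only [Nat.add_assoc, Nat.sub_sub]

theorem sumHom_assoc' (f : Fin m →o Fin m') (g : Fin n →o Fin n') (h : Fin k →o Fin k') :
    sumHom (sumHom f g) h = ((castHom (Nat.add_assoc m' n' k').symm).comp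
      (sumHom f (sumHom g h))).comp (castHom (Nat.add_assoc m n k)) :=
  congrArg (OrderHom.comp (castHom (Nat.add_assoc m' n' k').symm)) (sumHom_assoc f g h)

theorem sumHom_assoc_inv (f : Fin m →o Fin m') (g : Fin n →o Fin n') (h : Fin k →o Fin k') :
    (castHom (Nat.add_assoc m' n' k').symm).comp (sumHom f (sumHom g h)) =
      (sumHom (sumHom f g) h).comp (castHom (Nat.add_assoc m n k).symm) :=
  congrArg (OrderHom.comp · (castHom (Nat.add_assoc m n k).symm)) (sumHom_assoc' f g h).symm

theorem sumHom_exchange (f : Fin m →o Fin m') (g : Fin n →o Fin n') :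
    (sumHom f OrderHom.id).comp (sumHom OrderHom.id g) =
      (sumHom OrderHom.id g).comp (sumHom f OrderHom.id) := by
  rw [← sumHom_comp, ← sumHom_comp]
  rfl

theorem sumHom_whisker_left (f : Fin m →o Fin m') (g : Fin m' →o Fin k) :
    sumHom (OrderHom.id : Fin p →o Fin p) (g.comp f) =
      (sumHom OrderHom.id g).comp (sumHom OrderHom.id f) :=
  sumHom_comp OrderHom.id OrderHom.id f g

theorem sumHom_whisker_right (f : Fin m →o Fin m') (g : Fin m' →o Fin k) :
    sumHom (g.comp f) (OrderHom.id : Fin p →o Fin p) =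
      (sumHom g OrderHom.id).comp (sumHom f OrderHom.id) :=
  sumHom_comp f g OrderHom.id OrderHom.id

theorem sumHom_assoc_left (f : Fin m →o Fin m') :
    sumHom (OrderHom.id : Fin (p + q) →o Fin (p + q)) f =
      ((castHom (Nat.add_assoc p q m').symm).comp (sumHom OrderHom.id (sumHom OrderHom.id f))).comp
        (castHom (Nat.add_assoc p q m)) := by
  rw [← sumHom_id, sumHom_assoc']

theorem sumHom_assoc_right (f : Fin m →o Fin m') :
    sumHom f (OrderHom.id : Fin (p + q) →o Fin (p + q)) =
      ((castHom (Nat.add_assoc m' p q)).comp (sumHom (sumHom f OrderHom.id) OrderHom.id)).comp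
        (castHom (Nat.add_assoc m p q).symm) := by
  rw [← sumHom_id, sumHom_assoc]
  rfl

theorem castHom_eq {h : m = m} : castHom h = OrderHom.id := rfl

theorem sumHom_cast (h : m = m') (h' : n = n') :
    sumHom (castHom h) (castHom h') = castHom (by rw [h, h']) := by
  subst h h'
  exact sumHom_id _ _

theorem sumHom_pentagon (m n p q : ℕ) :
    ((sumHom (OrderHom.id : Fin m →o Fin m) (castHom (Nat.add_assoc n p q))).comp
        (castHom (Nat.add_assoc m (n + p) q))).comp
        (sumHom (castHom (Nat.add_assoc m n p)) (OrderHom.id : Fin q →o Fin q)) =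
      (castHom (Nat.add_assoc m n (p + q))).comp (castHom (Nat.add_assoc (m + n) p q)) := by
  rw [← castHom_eq (h := rfl), sumHom_cast, ← castHom_eq (h := rfl), sumHom_cast]
  rfl

theorem sumHom_triangle (m n : ℕ) :
    (sumHom (OrderHom.id : Fin m →o Fin m) (castHom (Nat.zero_add n))).comp
        (castHom (Nat.add_assoc m 0 n)) =
      sumHom (castHom (Nat.add_zero m)) (OrderHom.id : Fin n →o Fin n) := by
  rw [← castHom_eq (h := rfl), sumHom_cast, ← castHom_eq (h := rfl), sumHom_cast]
  rfl

theorem sumHom_pentagon_inv (m n p q : ℕ) :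
    (sumHom (castHom (Nat.add_assoc m n p).symm) (OrderHom.id : Fin q →o Fin q)).comp
        ((castHom (Nat.add_assoc m (n + p) q).symm).comp
          (sumHom (OrderHom.id : Fin m →o Fin m) (castHom (Nat.add_assoc n p q).symm))) =
      (castHom (Nat.add_assoc (m + n) p q).symm).comp
        (castHom (Nat.add_assoc m n (p + q)).symm) := by
  rw [← castHom_eq (h := rfl), sumHom_cast, ← castHom_eq (h := rfl), sumHom_cast]
  rfl

theorem sumHom_triangle_inv (m n : ℕ) :
    (castHom (Nat.add_assoc m 0 n).symm).comp
        (sumHom (OrderHom.id : Fin m →o Fin m) (castHom (Nat.zero_add n).symm)) =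
      sumHom (castHom (Nat.add_zero m).symm) (OrderHom.id : Fin n →o Fin n) := by
  rw [← castHom_eq (h := rfl), sumHom_cast, ← castHom_eq (h := rfl), sumHom_cast]
  rfl

theorem sumHom_square_left (f : Fin p →o Fin q) (g' : Fin k →o Fin m')
    (η : Fin n →o Fin m') (s : Fin m →o Fin n) (h : m = k)
    (H : η.comp s = g'.comp (castHom h)) :
    (sumHom OrderHom.id η).comp (sumHom f s) =
      (sumHom f g').comp (castHom (congrArg (p + ·) h)) := by
  subst h
  rw [← sumHom_comp, H]
  rfl

theorem sumHom_square_right (f : Fin p →o Fin q) (g' : Fin k →o Fin m')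
    (η : Fin n →o Fin m') (s : Fin m →o Fin n) (h : m = k)
    (H : η.comp s = g'.comp (castHom h)) :
    (sumHom η OrderHom.id).comp (sumHom s f) =
      (sumHom g' f).comp (castHom (congrArg (· + p) h)) := by
  subst h
  rw [← sumHom_comp, H]
  rfl

end SumHom

/-! ### Words in a graph -/

section Words

variable {G : Type u} [Quiver.{v} G]

/-- The number of edges of the graph that occur in a 1-cell of the free bicategory. -/
def wordEdges : ∀ {a b : FreeBicategory G}, (a ⟶ b) → ℕ
  | _, _, FreeBicategory.Hom.of _ => 1
  | _, _, FreeBicategory.Hom.id _ => 0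
  | _, _, FreeBicategory.Hom.comp f g => wordEdges f + wordEdges g

/-- The 1-cells of the target of the free (op)lax functor on a graph: parenthesized composable
words in formal units and in symbols `F(w)`, one for each 1-cell `w` of the free bicategory. -/
inductive OneCell : FreeBicategory G → FreeBicategory G → Type max u v
  | app {a b : FreeBicategory G} (w : a ⟶ b) : OneCell a b
  | unit (a : FreeBicategory G) : OneCell a a
  | comp {a b c : FreeBicategory G} (x : OneCell a b) (y : OneCell b c) : OneCell a c

namespace OneCell

/-- The number of edges of the graph that occur in a 1-cell. -/
def edges : ∀ {a b : FreeBicategory G}, OneCell a b → ℕ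
  | _, _, app w => wordEdges w
  | _, _, unit _ => 0
  | _, _, comp x y => edges x + edges y

/-- The number of terms `F(...)` that occur in a 1-cell. -/
def terms : ∀ {a b : FreeBicategory G}, OneCell a b → ℕ
  | _, _, app _ => 1
  | _, _, unit _ => 0
  | _, _, comp x y => terms x + terms y

/-- The map of ordered sets that sends (the position of) an edge to the (position of the) term
`F(...)` in which it occurs. -/
def support : ∀ {a b : FreeBicategory G} (x : OneCell a b), Fin x.edges →o Fin x.terms
  | _, _, app _ => ⟨fun _ => (0 : Fin 1), fun _ _ _ => le_rfl⟩
  | _, _, unit _ => OrderHom.id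
  | _, _, comp x y => sumHom (support x) (support y)

end OneCell

theorem wordEdges_eq₂ {a b : FreeBicategory G} {f g : a ⟶ b} (η : FreeBicategory.Hom₂ f g) :
    wordEdges f = wordEdges g := by
  induction η with
  | id => rfl
  | vcomp _ _ h h' => exact h.trans h'
  | whisker_left f _ h => exact congrArg (wordEdges f + ·) h
  | whisker_right f _ h => exact congrArg (· + wordEdges f) h
  | associator => exact Nat.add_assoc _ _ _
  | associator_inv => exact (Nat.add_assoc _ _ _).symm
  | right_unitor => exact Nat.add_zero _
  | right_unitor_inv => exact (Nat.add_zero _).symm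
  | left_unitor => exact Nat.zero_add _
  | left_unitor_inv => exact (Nat.zero_add _).symm

theorem wordEdges_eq {a b : FreeBicategory G} {f g : a ⟶ b} (η : f ⟶ g) :
    wordEdges f = wordEdges g := by
  induction η using Quot.ind with
  | mk η => exact wordEdges_eq₂ η

end Words

/-- The strict functor from the free bicategory on the underlying graph of a bicategory `C` to `C`
that is the identity on 0-cells and on edges. -/
def base (C : Type u₁) [Bicategory.{w₁, v₁} C] : Pseudofunctor (FreeBicategory C) C :=
  FreeBicategory.lift (Prefunctor.id C)

/-! ### Bicategories presented by 2-cells -/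

section Presentation

variable {G : Type u} [Quiver.{v} G]

variable (G) in
/-- A family of generating 2-cells between the 1-cells. -/
abbrev Generators : Type (max u (v + 1) (u + 1)) :=
  ∀ ⦃a b : FreeBicategory G⦄, OneCell a b → OneCell a b → Type max u v

/-- Formal composites of associators, unitors and given generating 2-cells. -/
inductive Hom₂ (gen : Generators G) :
    ∀ {a b : FreeBicategory G}, OneCell a b → OneCell a b → Type max u v
  | of {a b : FreeBicategory G} {f g : OneCell a b} (η : gen f g) : Hom₂ gen f g
  | id {a b : FreeBicategory G} (f : OneCell a b) : Hom₂ gen f f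
  | vcomp {a b : FreeBicategory G} {f g h : OneCell a b} (η : Hom₂ gen f g) (θ : Hom₂ gen g h) :
      Hom₂ gen f h
  | whisker_left {a b c : FreeBicategory G} (f : OneCell a b) {g h : OneCell b c}
      (η : Hom₂ gen g h) : Hom₂ gen (f.comp g) (f.comp h)
  | whisker_right {a b c : FreeBicategory G} {f g : OneCell a b} (h : OneCell b c)
      (η : Hom₂ gen f g) : Hom₂ gen (f.comp h) (g.comp h)
  | associator {a b c d : FreeBicategory G} (f : OneCell a b) (g : OneCell b c)
      (h : OneCell c d) : Hom₂ gen ((f.comp g).comp h) (f.comp (g.comp h))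
  | associator_inv {a b c d : FreeBicategory G} (f : OneCell a b) (g : OneCell b c)
      (h : OneCell c d) : Hom₂ gen (f.comp (g.comp h)) ((f.comp g).comp h)
  | right_unitor {a b : FreeBicategory G} (f : OneCell a b) : Hom₂ gen (f.comp (OneCell.unit b)) f
  | right_unitor_inv {a b : FreeBicategory G} (f : OneCell a b) :
      Hom₂ gen f (f.comp (OneCell.unit b))
  | left_unitor {a b : FreeBicategory G} (f : OneCell a b) : Hom₂ gen ((OneCell.unit a).comp f) f
  | left_unitor_inv {a b : FreeBicategory G} (f : OneCell a b) :
      Hom₂ gen f ((OneCell.unit a).comp f)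

/-- A family of relations between formal composites of 2-cells. -/
abbrev Relations (gen : Generators G) : Type max u v :=
  ∀ ⦃a b : FreeBicategory G⦄ ⦃f g : OneCell a b⦄, Hom₂ gen f g → Hom₂ gen f g → Prop

local infixr:80 " ⬝ " => Hom₂.vcomp

/-- The relations imposed by a given family of relations and the axioms of a bicategory. -/
inductive Rel {gen : Generators G} (R : Relations gen) :
    ∀ {a b : FreeBicategory G} {f g : OneCell a b}, Hom₂ gen f g → Hom₂ gen f g → Prop
  | of {a b : FreeBicategory G} {f g : OneCell a b} {η θ : Hom₂ gen f g} (h : R η θ) : Rel R η θ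
  | vcomp_right {a b : FreeBicategory G} {f g h : OneCell a b} (η : Hom₂ gen f g) (θ₁ θ₂ : Hom₂ gen g h) :
      Rel R θ₁ θ₂ → Rel R (η ⬝ θ₁) (η ⬝ θ₂)
  | vcomp_left {a b : FreeBicategory G} {f g h : OneCell a b} (η₁ η₂ : Hom₂ gen f g) (θ : Hom₂ gen g h) :
      Rel R η₁ η₂ → Rel R (η₁ ⬝ θ) (η₂ ⬝ θ)
  | id_comp {a b : FreeBicategory G} {f g : OneCell a b} (η : Hom₂ gen f g) : Rel R (.id f ⬝ η) η
  | comp_id {a b : FreeBicategory G} {f g : OneCell a b} (η : Hom₂ gen f g) : Rel R (η ⬝ .id g) η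
  | assoc {a b : FreeBicategory G} {f g h i : OneCell a b} (η : Hom₂ gen f g) (θ : Hom₂ gen g h) (ι : Hom₂ gen h i) :
      Rel R ((η ⬝ θ) ⬝ ι) (η ⬝ θ ⬝ ι)
  | whisker_left {a b c : FreeBicategory G} (f : OneCell a b) (g h : OneCell b c) (η η' : Hom₂ gen g h) :
      Rel R η η' → Rel R (.whisker_left f η) (.whisker_left f η')
  | whisker_left_id {a b c : FreeBicategory G} (f : OneCell a b) (g : OneCell b c) :
      Rel R (.whisker_left f (.id g)) (.id (f.comp g))
  | whisker_left_comp {a b c : FreeBicategory G} (f : OneCell a b) {g h i : OneCell b c} (η : Hom₂ gen g h)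
      (θ : Hom₂ gen h i) :
      Rel R (.whisker_left f (η ⬝ θ)) (.whisker_left f η ⬝ .whisker_left f θ)
  | id_whisker_left {a b : FreeBicategory G} {f g : OneCell a b} (η : Hom₂ gen f g) :
      Rel R (.whisker_left (OneCell.unit a) η) (.left_unitor f ⬝ η ⬝ .left_unitor_inv g)
  | comp_whisker_left {a b c d : FreeBicategory G} (f : OneCell a b) (g : OneCell b c) {h h' : OneCell c d}
      (η : Hom₂ gen h h') :
      Rel R (.whisker_left (f.comp g) η)
        (.associator f g h ⬝ .whisker_left f (.whisker_left g η) ⬝ .associator_inv f g h')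
  | whisker_right {a b c : FreeBicategory G} (f g : OneCell a b) (h : OneCell b c) (η η' : Hom₂ gen f g) :
      Rel R η η' → Rel R (.whisker_right h η) (.whisker_right h η')
  | id_whisker_right {a b c : FreeBicategory G} (f : OneCell a b) (g : OneCell b c) :
      Rel R (.whisker_right g (.id f)) (.id (f.comp g))
  | comp_whisker_right {a b c : FreeBicategory G} {f g h : OneCell a b} (i : OneCell b c) (η : Hom₂ gen f g)
      (θ : Hom₂ gen g h) :
      Rel R (.whisker_right i (η ⬝ θ)) (.whisker_right i η ⬝ .whisker_right i θ)
  | whisker_right_id {a b : FreeBicategory G} {f g : OneCell a b} (η : Hom₂ gen f g) :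
      Rel R (.whisker_right (OneCell.unit b) η) (.right_unitor f ⬝ η ⬝ .right_unitor_inv g)
  | whisker_right_comp {a b c d : FreeBicategory G} {f f' : OneCell a b} (g : OneCell b c) (h : OneCell c d)
      (η : Hom₂ gen f f') :
      Rel R (.whisker_right (g.comp h) η)
        (.associator_inv f g h ⬝ .whisker_right h (.whisker_right g η) ⬝ .associator f' g h)
  | whisker_assoc {a b c d : FreeBicategory G} (f : OneCell a b) {g g' : OneCell b c} (η : Hom₂ gen g g')
      (h : OneCell c d) :
      Rel R (.whisker_right h (.whisker_left f η))
        (.associator f g h ⬝ .whisker_left f (.whisker_right h η) ⬝ .associator_inv f g' h)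
  | whisker_exchange {a b c : FreeBicategory G} {f g : OneCell a b} {h i : OneCell b c} (η : Hom₂ gen f g)
      (θ : Hom₂ gen h i) :
      Rel R (.whisker_left f θ ⬝ .whisker_right i η) (.whisker_right h η ⬝ .whisker_left g θ)
  | associator_hom_inv {a b c d : FreeBicategory G} (f : OneCell a b) (g : OneCell b c) (h : OneCell c d) :
      Rel R (.associator f g h ⬝ .associator_inv f g h) (.id ((f.comp g).comp h))
  | associator_inv_hom {a b c d : FreeBicategory G} (f : OneCell a b) (g : OneCell b c) (h : OneCell c d) :
      Rel R (.associator_inv f g h ⬝ .associator f g h) (.id (f.comp (g.comp h)))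
  | left_unitor_hom_inv {a b : FreeBicategory G} (f : OneCell a b) :
      Rel R (.left_unitor f ⬝ .left_unitor_inv f) (.id ((OneCell.unit a).comp f))
  | left_unitor_inv_hom {a b : FreeBicategory G} (f : OneCell a b) :
      Rel R (.left_unitor_inv f ⬝ .left_unitor f) (.id f)
  | right_unitor_hom_inv {a b : FreeBicategory G} (f : OneCell a b) :
      Rel R (.right_unitor f ⬝ .right_unitor_inv f) (.id (f.comp (OneCell.unit b)))
  | right_unitor_inv_hom {a b : FreeBicategory G} (f : OneCell a b) :
      Rel R (.right_unitor_inv f ⬝ .right_unitor f) (.id f)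
  | pentagon {a b c d e : FreeBicategory G} (f : OneCell a b) (g : OneCell b c) (h : OneCell c d) (i : OneCell d e) :
      Rel R (.whisker_right i (.associator f g h) ⬝ .associator f (g.comp h) i ⬝
          .whisker_left f (.associator g h i))
        (.associator (f.comp g) h i ⬝ .associator f g (h.comp i))
  | triangle {a b c : FreeBicategory G} (f : OneCell a b) (g : OneCell b c) :
      Rel R (.associator f (OneCell.unit b) g ⬝ .whisker_left f (.left_unitor g))
        (.whisker_right g (.right_unitor f))

/-- The bicategory with 0-cells the vertices of the graph, with 1-cells the words in formal units
and symbols `F(w)`, and with 2-cells presented by the given generators and relations, in addition to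
the associators, the unitors and the axioms of a bicategory. -/
def Presented {gen : Generators G} (_R : Relations gen) : Type u := FreeBicategory G

variable {gen : Generators G} {R : Relations gen}

instance : CategoryStruct.{max u v} (Presented R) where
  Hom a b := OneCell (G := G) a b
  id a := OneCell.unit (G := G) a
  comp x y := OneCell.comp (G := G) x y

instance Presented.homCategory (a b : Presented R) : Category (a ⟶ b) where
  Hom f g := Quot (@Rel _ _ _ R a b f g)
  id f := Quot.mk (Rel R) (Hom₂.id f)
  comp := @fun _ _ _ => Quot.map₂ Hom₂.vcomp Rel.vcomp_right Rel.vcomp_left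
  id_comp := by
    rintro f g ⟨η⟩
    exact Quot.sound (Rel.id_comp η)
  comp_id := by
    rintro f g ⟨η⟩
    exact Quot.sound (Rel.comp_id η)
  assoc := by
    rintro f g h i ⟨η⟩ ⟨θ⟩ ⟨ι⟩
    exact Quot.sound (Rel.assoc η θ ι)

instance Presented.bicategory : Bicategory (Presented R) where
  homCategory a b := Presented.homCategory a b
  whiskerLeft := @fun _ _ _ f g h η => Quot.map (Hom₂.whisker_left f) (Rel.whisker_left f g h) η
  whiskerLeft_id := @fun _ _ _ f g => Quot.sound (Rel.whisker_left_id f g)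
  associator := @fun _ _ _ _ f g h =>
    { hom := Quot.mk (Rel R) (Hom₂.associator f g h)
      inv := Quot.mk (Rel R) (Hom₂.associator_inv f g h)
      hom_inv_id := Quot.sound (Rel.associator_hom_inv f g h)
      inv_hom_id := Quot.sound (Rel.associator_inv_hom f g h) }
  leftUnitor := @fun _ _ f =>
    { hom := Quot.mk (Rel R) (Hom₂.left_unitor f)
      inv := Quot.mk (Rel R) (Hom₂.left_unitor_inv f)
      hom_inv_id := Quot.sound (Rel.left_unitor_hom_inv f)
      inv_hom_id := Quot.sound (Rel.left_unitor_inv_hom f) }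
  rightUnitor := @fun _ _ f =>
    { hom := Quot.mk (Rel R) (Hom₂.right_unitor f)
      inv := Quot.mk (Rel R) (Hom₂.right_unitor_inv f)
      hom_inv_id := Quot.sound (Rel.right_unitor_hom_inv f)
      inv_hom_id := Quot.sound (Rel.right_unitor_inv_hom f) }
  whiskerLeft_comp := by
    rintro a b c f g h i ⟨η⟩ ⟨θ⟩
    exact Quot.sound (Rel.whisker_left_comp f η θ)
  id_whiskerLeft := by
    rintro a b f g ⟨η⟩
    exact Quot.sound (Rel.id_whisker_left η)
  comp_whiskerLeft := by
    rintro a b c d f g h h' ⟨η⟩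
    exact Quot.sound (Rel.comp_whisker_left f g η)
  whiskerRight := @fun _ _ _ f g η h => Quot.map (Hom₂.whisker_right h) (Rel.whisker_right f g h) η
  id_whiskerRight := @fun _ _ _ f g => Quot.sound (Rel.id_whisker_right f g)
  comp_whiskerRight := by
    rintro a b c f g h ⟨η⟩ ⟨θ⟩ i
    exact Quot.sound (Rel.comp_whisker_right i η θ)
  whiskerRight_id := by
    rintro a b f g ⟨η⟩
    exact Quot.sound (Rel.whisker_right_id η)
  whiskerRight_comp := by
    rintro a b c d f f' ⟨η⟩ g h
    exact Quot.sound (Rel.whisker_right_comp g h η)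
  whisker_assoc := by
    rintro a b c d f g g' ⟨η⟩ h
    exact Quot.sound (Rel.whisker_assoc f η h)
  whisker_exchange := by
    rintro a b c f g h i ⟨η⟩ ⟨θ⟩
    exact Quot.sound (Rel.whisker_exchange η θ)
  pentagon := @fun _ _ _ _ _ f g h i => Quot.sound (Rel.pentagon f g h i)
  triangle := @fun _ _ _ f g => Quot.sound (Rel.triangle f g)


variable (R) in
/-- The 0-cell `F(a)`. -/
def vertex (a : FreeBicategory G) : Presented R := a

variable (R) in
/-- The 1-cell `F(w)`. -/
def app {a b : FreeBicategory G} (w : a ⟶ b) : vertex R a ⟶ vertex R b := OneCell.app w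

/-- The number of edges in a 1-cell. -/
def edges {a b : Presented R} (x : a ⟶ b) : ℕ := OneCell.edges (G := G) x

/-- The number of terms `F(...)` in a 1-cell. -/
def terms {a b : Presented R} (x : a ⟶ b) : ℕ := OneCell.terms (G := G) x

/-- The supporting map of a 1-cell, from its edges to its terms `F(...)`. -/
def support {a b : Presented R} (x : a ⟶ b) : Fin (edges x) →o Fin (terms x) :=
  OneCell.support (G := G) x

theorem edges_eq₂ (H : ∀ ⦃a b : FreeBicategory G⦄ ⦃x y : OneCell a b⦄, gen x y → x.edges = y.edges)
    {a b : FreeBicategory G} {x y : OneCell a b} (η : Hom₂ gen x y) : x.edges = y.edges := by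
  induction η with
  | of η => exact H η
  | id => rfl
  | vcomp _ _ h h' => exact h.trans h'
  | whisker_left f _ h => exact congrArg (f.edges + ·) h
  | whisker_right f _ h => exact congrArg (· + f.edges) h
  | associator => exact Nat.add_assoc _ _ _
  | associator_inv => exact (Nat.add_assoc _ _ _).symm
  | right_unitor => exact Nat.add_zero _
  | right_unitor_inv => exact (Nat.add_zero _).symm
  | left_unitor => exact Nat.zero_add _
  | left_unitor_inv => exact (Nat.zero_add _).symm

theorem edges_eq (H : ∀ ⦃a b : FreeBicategory G⦄ ⦃x y : OneCell a b⦄, gen x y → x.edges = y.edges)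
    {a b : Presented R} {x y : a ⟶ b} (η : x ⟶ y) : edges x = edges y := by
  induction η using Quot.ind with
  | mk η => exact edges_eq₂ H η

theorem edges_eq_of_component
    (H : ∀ ⦃a b : FreeBicategory G⦄ ⦃x y : OneCell a b⦄, gen x y → x.edges = y.edges)
    {a b : Presented R} {W x : a ⟶ b}
    (h : (CategoryTheory.ConnectedComponents.mk W).objectProperty x) : edges W = edges x := by
  have hz : Zigzag x W := Quotient.exact h
  clear h
  induction hz with
  | refl => rfl
  | tail _ hs ih =>
    rcases hs with hs | hs
    · exact (edges_eq H hs.some).symm.trans ih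
    · exact (edges_eq H hs.some).trans ih

section Evaluation

variable {D : Type u₂} [Bicategory.{w₂, v₂} D] {o : FreeBicategory G → D}
  (p : ∀ {a b : FreeBicategory G}, (a ⟶ b) → (o a ⟶ o b))

/-- The value in a bicategory `D` of a 1-cell, given the values of the symbols `F(w)`. -/
def evalHom : ∀ {a b : FreeBicategory G}, OneCell a b → (o a ⟶ o b)
  | _, _, .app w => p w
  | _, _, .unit _ => 𝟙 _
  | _, _, .comp x y => evalHom x ≫ evalHom y

variable (q : ∀ {a b : FreeBicategory G} {x y : OneCell a b}, gen x y → (evalHom p x ⟶ evalHom p y))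

/-- The value in `D` of a formal composite of 2-cells, given the values of the generators. -/
def evalHom₂ : ∀ {a b : FreeBicategory G} {x y : OneCell a b},
    Hom₂ gen x y → (evalHom p x ⟶ evalHom p y)
  | _, _, _, _, .of η => q η
  | _, _, _, _, .id _ => 𝟙 _
  | _, _, _, _, .vcomp η θ => evalHom₂ η ≫ evalHom₂ θ
  | _, _, _, _, .whisker_left f η => evalHom p f ◁ evalHom₂ η
  | _, _, _, _, .whisker_right f η => evalHom₂ η ▷ evalHom p f
  | _, _, _, _, .associator _ _ _ => (α_ _ _ _).hom
  | _, _, _, _, .associator_inv _ _ _ => (α_ _ _ _).inv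
  | _, _, _, _, .right_unitor _ => (ρ_ _).hom
  | _, _, _, _, .right_unitor_inv _ => (ρ_ _).inv
  | _, _, _, _, .left_unitor _ => (λ_ _).hom
  | _, _, _, _, .left_unitor_inv _ => (λ_ _).inv

theorem evalHom₂_congr
    (H : ∀ {a b : FreeBicategory G} {x y : OneCell a b} {η θ : Hom₂ gen x y},
      R η θ → evalHom₂ p q η = evalHom₂ p q θ)
    {a b : FreeBicategory G} {x y : OneCell a b} {η θ : Hom₂ gen x y} (h : Rel R η θ) :
    evalHom₂ p q η = evalHom₂ p q θ := by
  induction h with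
  | of h => exact H h
  | vcomp_right η _ _ _ ih => exact congrArg (evalHom₂ p q η ≫ ·) ih
  | vcomp_left _ _ θ _ ih => exact congrArg (· ≫ evalHom₂ p q θ) ih
  | id_comp => exact Category.id_comp _
  | comp_id => exact Category.comp_id _
  | assoc => exact Category.assoc _ _ _
  | whisker_left f _ _ _ _ _ ih => exact congrArg (evalHom p f ◁ ·) ih
  | whisker_left_id => exact Bicategory.whiskerLeft_id _ _
  | whisker_left_comp => exact Bicategory.whiskerLeft_comp _ _ _
  | id_whisker_left η => exact Bicategory.id_whiskerLeft _
  | comp_whisker_left => exact Bicategory.comp_whiskerLeft _ _ _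
  | whisker_right _ _ f _ _ _ ih => exact congrArg (· ▷ evalHom p f) ih
  | id_whisker_right => exact Bicategory.id_whiskerRight _ _
  | comp_whisker_right => exact Bicategory.comp_whiskerRight _ _ _
  | whisker_right_id => exact Bicategory.whiskerRight_id _
  | whisker_right_comp => exact Bicategory.whiskerRight_comp _ _ _
  | whisker_assoc => exact Bicategory.whisker_assoc _ _ _
  | whisker_exchange => exact Bicategory.whisker_exchange _ _
  | associator_hom_inv => exact Iso.hom_inv_id _
  | associator_inv_hom => exact Iso.inv_hom_id _
  | left_unitor_hom_inv => exact Iso.hom_inv_id _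
  | left_unitor_inv_hom => exact Iso.inv_hom_id _
  | right_unitor_hom_inv => exact Iso.hom_inv_id _
  | right_unitor_inv_hom => exact Iso.inv_hom_id _
  | pentagon => exact Bicategory.pentagon _ _ _ _
  | triangle => exact Bicategory.triangle _ _

/-- The strict functor to `D` given by the values of the symbols `F(w)` and of the generators. -/
def evaluation
    (H : ∀ {a b : FreeBicategory G} {x y : OneCell a b} {η θ : Hom₂ gen x y},
      R η θ → evalHom₂ p q η = evalHom₂ p q θ) : StrictPseudofunctor (Presented R) D :=
  StrictPseudofunctor.mk'
    { obj := fun a => o a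
      map := fun x => evalHom p x
      map₂ := fun η => Quot.lift (evalHom₂ p q) (fun _ _ h => evalHom₂_congr p q H h) η
      map₂_id := fun _ => rfl
      map₂_comp := by
        rintro a b f g h ⟨η⟩ ⟨θ⟩
        rfl
      map_id := fun _ => rfl
      map_comp := fun _ _ => rfl
      map₂_whisker_left := by
        rintro a b c f g h ⟨η⟩
        exact eq_eqToHom_comp_comp _
      map₂_whisker_right := by
        rintro a b c f g ⟨η⟩ h
        exact eq_eqToHom_comp_comp _
      map₂_left_unitor := fun f => eq_eqToHom_comp _
      map₂_right_unitor := fun f => eq_eqToHom_comp _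
      map₂_associator := fun f g h => eq_eqToHom_comp_comp _ }

end Evaluation

end Presentation

/-! ### Diagrams -/

/-- A diagram, of shape a graph `J`, in a category commutes if the composites along any two
parallel paths agree. -/
def Commutes {J : Type w} [Quiver.{w'} J] {A : Type u} [Category.{v} A] (X : J ⥤q A) : Prop :=
  ∀ ⦃i j : J⦄ (p q : Quiver.Path i j), (Paths.lift X).map p = (Paths.lift X).map q

/-! ### The free lax functor on a graph -/

namespace FreeLax

section Construction

variable {G : Type u} [Quiver.{v} G]

/-- The generating 2-cells of the target of the free lax functor: the images under `F` of the
2-cells of the free bicategory, the unit maps `1 ⟶ F(1)`, and the composition maps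
`F(w) F(w') ⟶ F(w w')`. -/
inductive Gen : ∀ ⦃a b : FreeBicategory G⦄, OneCell a b → OneCell a b → Type max u v
  | map₂ {a b : FreeBicategory G} {f g : a ⟶ b} (η : f ⟶ g) : Gen (.app f) (.app g)
  | map_id (a : FreeBicategory G) : Gen (.unit a) (.app (𝟙 a))
  | map_comp {a b c : FreeBicategory G} (f : a ⟶ b) (g : b ⟶ c) :
      Gen ((OneCell.app f).comp (.app g)) (.app (f ≫ g))

local infixr:80 " ⬝ " => Hom₂.vcomp

/-- The relations between the generating 2-cells: the axioms of a lax functor. -/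
inductive Law : ∀ ⦃a b : FreeBicategory G⦄ ⦃x y : OneCell a b⦄,
    Hom₂ (@Gen G _) x y → Hom₂ (@Gen G _) x y → Prop
  | map₂_id {a b : FreeBicategory G} (f : a ⟶ b) : Law (.of (.map₂ (𝟙 f))) (.id (.app f))
  | map₂_comp {a b : FreeBicategory G} {f g h : a ⟶ b} (η : f ⟶ g) (θ : g ⟶ h) :
      Law (.of (.map₂ (η ≫ θ))) (.of (.map₂ η) ⬝ .of (.map₂ θ))
  | map_comp_naturality_left {a b c : FreeBicategory G} {f f' : a ⟶ b} (η : f ⟶ f')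
      (g : b ⟶ c) :
      Law (.of (.map_comp f g) ⬝ .of (.map₂ (η ▷ g)))
        (.whisker_right (.app g) (.of (.map₂ η)) ⬝ .of (.map_comp f' g))
  | map_comp_naturality_right {a b c : FreeBicategory G} (f : a ⟶ b) {g g' : b ⟶ c}
      (η : g ⟶ g') :
      Law (.of (.map_comp f g) ⬝ .of (.map₂ (f ◁ η)))
        (.whisker_left (.app f) (.of (.map₂ η)) ⬝ .of (.map_comp f g'))
  | map₂_associator {a b c d : FreeBicategory G} (f : a ⟶ b) (g : b ⟶ c) (h : c ⟶ d) :
      Law (.whisker_right (.app h) (.of (.map_comp f g)) ⬝ .of (.map_comp (f ≫ g) h) ⬝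
          .of (.map₂ (α_ f g h).hom))
        (.associator (.app f) (.app g) (.app h) ⬝ .whisker_left (.app f) (.of (.map_comp g h)) ⬝
          .of (.map_comp f (g ≫ h)))
  | map₂_left_unitor {a b : FreeBicategory G} (f : a ⟶ b) :
      Law (.whisker_right (.app f) (.of (.map_id a)) ⬝ .of (.map_comp (𝟙 a) f) ⬝
          .of (.map₂ (λ_ f).hom))
        (.left_unitor (.app f))
  | map₂_right_unitor {a b : FreeBicategory G} (f : a ⟶ b) :
      Law (.whisker_left (.app f) (.of (.map_id b)) ⬝ .of (.map_comp f (𝟙 b)) ⬝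
          .of (.map₂ (ρ_ f).hom))
        (.right_unitor (.app f))

end Construction

end FreeLax

/-- The target of the free lax functor on a graph. -/
abbrev FreeLax (G : Type u) [Quiver.{v} G] : Type u := Presented (@FreeLax.Law G _)

namespace FreeLax

section Construction

variable {G : Type u} [Quiver.{v} G]

theorem map₂_inv {a b : FreeBicategory G} {f g : a ⟶ b} (e : f ≅ g) :
    (Quot.mk (Rel Law) (Hom₂.of (.map₂ e.hom)) : app Law f ⟶ app Law g) ≫
      (Quot.mk (Rel Law) (Hom₂.of (.map₂ e.inv)) : app Law g ⟶ app Law f) = 𝟙 (app Law f) :=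
  (Quot.sound (.of (Law.map₂_comp e.hom e.inv))).symm.trans
    ((congrArg (fun η => Quot.mk (Rel Law) (Hom₂.of (.map₂ η))) e.hom_inv_id).trans
      (Quot.sound (.of (Law.map₂_id f))))

variable (G) in
/-- The free lax functor on a graph, from the free bicategory on the graph. -/
def free : LaxFunctor (FreeBicategory G) (FreeLax G) where
  obj a := vertex Law a
  map w := app Law w
  map₂ η := Quot.mk (Rel Law) (Hom₂.of (.map₂ η))
  map₂_id f := Quot.sound (.of (Law.map₂_id f))
  map₂_comp η θ := Quot.sound (.of (Law.map₂_comp η θ))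
  mapId a := Quot.mk (Rel Law) (Hom₂.of (.map_id a))
  mapComp f g := Quot.mk (Rel Law) (Hom₂.of (.map_comp f g))
  mapComp_naturality_left η g := Quot.sound (.of (Law.map_comp_naturality_left η g))
  mapComp_naturality_right f _ _ η := Quot.sound (.of (Law.map_comp_naturality_right f η))
  map₂_associator f g h := Quot.sound (.of (Law.map₂_associator f g h))
  map₂_leftUnitor f :=
    eq_inv_comp_of_retraction (λ_ (app Law f)) _ _ (Quot.mk (Rel Law) (Hom₂.of (.map₂ (λ_ f).hom))) _
      (map₂_inv _) (Quot.sound (.of (Law.map₂_left_unitor f)))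
  map₂_rightUnitor f :=
    eq_inv_comp_of_retraction (ρ_ (app Law f)) _ _ (Quot.mk (Rel Law) (Hom₂.of (.map₂ (ρ_ f).hom))) _
      (map₂_inv _) (Quot.sound (.of (Law.map₂_right_unitor f)))

/-- The supporting map of a formal composite of generating 2-cells. Associators, unitors and
2-cells inside a term `F(...)` induce identity maps; unit maps create a new term (expanded
instances are coface maps); composition maps fold two adjacent terms together (expanded instances
are codegeneracy maps). -/
def supportHom₂ : ∀ {a b : FreeBicategory G} {x y : OneCell a b}, Hom₂ Gen x y → (Fin (x.terms) →o Fin (y.terms))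
  | _, _, _, _, .id _ => OrderHom.id
  | _, _, _, _, .vcomp η θ => (supportHom₂ θ).comp (supportHom₂ η)
  | _, _, _, _, .whisker_left _ η => sumHom OrderHom.id (supportHom₂ η)
  | _, _, _, _, .whisker_right _ η => sumHom (supportHom₂ η) OrderHom.id
  | _, _, _, _, .associator _ _ _ => castHom (Nat.add_assoc _ _ _)
  | _, _, _, _, .associator_inv _ _ _ => castHom (Nat.add_assoc _ _ _).symm
  | _, _, _, _, .right_unitor _ => castHom (Nat.add_zero _)
  | _, _, _, _, .right_unitor_inv _ => castHom (Nat.add_zero _).symm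
  | _, _, _, _, .left_unitor _ => castHom (Nat.zero_add _)
  | _, _, _, _, .left_unitor_inv _ => castHom (Nat.zero_add _).symm
  | _, _, _, _, .of (.map₂ _) => (OrderHom.id : Fin 1 →o Fin 1)
  | _, _, _, _, .of (.map_id _) => ⟨fun i : Fin 0 => i.elim0, fun i => i.elim0⟩
  | _, _, _, _, .of (.map_comp _ _) => ⟨fun _ => (0 : Fin 1), fun _ _ _ => le_rfl⟩

theorem edges_gen ⦃a b : FreeBicategory G⦄ ⦃x y : OneCell a b⦄ (η : Gen x y) :
    x.edges = y.edges := by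
  cases η with
  | map₂ η => exact wordEdges_eq η
  | map_id => rfl
  | map_comp => rfl

theorem supportHom₂_congr {a b : FreeBicategory G} {x y : OneCell a b} {η θ : Hom₂ Gen x y}
    (h : Rel Law η θ) :
    supportHom₂ η = supportHom₂ θ := by
  induction h with
  | vcomp_right η _ _ _ ih => exact congrArg (OrderHom.comp · (supportHom₂ η)) ih
  | vcomp_left _ _ θ _ ih => exact congrArg (OrderHom.comp (supportHom₂ θ) ·) ih
  | id_comp => rfl
  | comp_id => rfl
  | assoc => rfl
  | whisker_left f _ _ _ _ _ ih =>
    exact congrArg (sumHom (OrderHom.id : Fin (f.terms) →o Fin (f.terms)) ·) ih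
  | whisker_right _ _ f _ _ _ ih =>
    exact congrArg (sumHom · (OrderHom.id : Fin (f.terms) →o Fin (f.terms))) ih
  | whisker_left_id => exact sumHom_id _ _
  | whisker_left_comp => exact sumHom_whisker_left _ _
  | id_whisker_right => exact sumHom_id _ _
  | comp_whisker_right => exact sumHom_whisker_right _ _
  | id_whisker_left η => exact sumHom_empty_left _
  | comp_whisker_left => exact sumHom_assoc_left _
  | whisker_right_id => exact sumHom_empty_right _
  | whisker_right_comp => exact sumHom_assoc_right _
  | whisker_assoc => exact sumHom_assoc' _ _ _
  | whisker_exchange => exact sumHom_exchange _ _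
  | associator_hom_inv => rfl
  | associator_inv_hom => rfl
  | left_unitor_hom_inv => rfl
  | left_unitor_inv_hom => rfl
  | right_unitor_hom_inv => rfl
  | right_unitor_inv_hom => rfl
  | pentagon => exact sumHom_pentagon _ _ _ _
  | triangle => exact sumHom_triangle _ _
  | of h =>
    cases h with
    | map₂_id => rfl
    | map₂_comp => rfl
    | _ => exact OrderHom.ext _ _ (funext fun _ => Subsingleton.elim (α := Fin 1) _ _)

theorem supportHom₂_support {a b : FreeBicategory G} {x y : OneCell a b} (η : Hom₂ Gen x y) :
    (supportHom₂ η).comp x.support = y.support.comp (castHom (edges_eq₂ edges_gen η)) := by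
  induction η with
  | id => rfl
  | vcomp η θ h h' =>
    change (supportHom₂ θ).comp ((supportHom₂ η).comp (OneCell.support _)) = _
    rw [h]
    change ((supportHom₂ θ).comp (OneCell.support _)).comp (castHom (edges_eq₂ edges_gen η)) = _
    rw [h']
    rfl
  | whisker_left f η h => exact sumHom_square_left f.support _ _ _ _ h
  | whisker_right f η h => exact sumHom_square_right f.support _ _ _ _ h
  | associator f g h => exact sumHom_assoc f.support g.support h.support
  | associator_inv f g h => exact sumHom_assoc_inv f.support g.support h.support
  | right_unitor f => exact (congrArg (OrderHom.comp (castHom (Nat.add_zero f.terms))) (sumHom_empty_right f.support))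
  | right_unitor_inv f => exact (congrArg (OrderHom.comp · (castHom (Nat.add_zero f.edges).symm)) (sumHom_empty_right f.support).symm)
  | left_unitor f => exact (congrArg (OrderHom.comp (castHom (Nat.zero_add f.terms))) (sumHom_empty_left f.support))
  | left_unitor_inv f => exact (congrArg (OrderHom.comp · (castHom (Nat.zero_add f.edges).symm)) (sumHom_empty_left f.support).symm)
  | of η =>
    cases η with
    | map_id => exact OrderHom.ext _ _ (funext fun i : Fin 0 => i.elim0)
    | _ => exact OrderHom.ext _ _ (funext fun _ => Subsingleton.elim (α := Fin 1) _ _)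

/-- The supporting map of a 2-cell. -/
def supportHom {a b : FreeLax G} {x y : a ⟶ b} (η : x ⟶ y) : Fin (terms x) →o Fin (terms y) :=
  Quot.lift supportHom₂ (fun _ _ h => supportHom₂_congr h) η

theorem supportHom_comp {a b : FreeLax G} {x y z : a ⟶ b} (η : x ⟶ y) (θ : y ⟶ z) :
    supportHom (η ≫ θ) = (supportHom θ).comp (supportHom η) := by
  induction η using Quot.ind with
  | mk η =>
    induction θ using Quot.ind with
    | mk θ => rfl

theorem supportHom_support {a b : FreeLax G} {x y : a ⟶ b} (η : x ⟶ y) :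
    (supportHom η).comp (support x) = (support y).comp (castHom (edges_eq edges_gen η)) := by
  induction η using Quot.ind with
  | mk η => exact supportHom₂_support η

/-- The supporting set functor, from the component of a 1-cell `W` with `n` edges to the category
of objects under `n` in `Δ`. -/
def supportFunctor {a b : FreeLax G} (W : a ⟶ b) :
    (CategoryTheory.ConnectedComponents.mk W).Component ⥤ Under (Delta.mk (edges W)) where
  obj x := Under.mk (Y := Delta.mk (terms x.obj))
    ((support x.obj).comp (castHom (edges_eq_of_component edges_gen x.property)))
  map {x y} η := Under.homMk (supportHom η.hom) (by
    change (supportHom η.hom).comp ((support x.obj).comp (castHom _)) = _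
    rw [← OrderHom.comp_assoc, supportHom_support]
    rfl)
  map_id x := rfl
  map_comp η θ := by
    apply Under.UnderMorphism.ext
    exact supportHom_comp η.hom θ.hom

end Construction

/-! ### Formal diagrams of lax functors -/

section Formal

variable {C : Type u₁} [Bicategory.{w₁, v₁} C] {D : Type u₂} [Bicategory.{w₂, v₂} D]

/-- The value of the 1-cell `F(w)` in `D`. -/
def evalApp (F : LaxFunctor C D) {a b : FreeBicategory C} (w : a ⟶ b) : F.obj a ⟶ F.obj b :=
  F.map ((base C).map w)

/-- The values of the generating 2-cells in `D`. -/
def evalGen (F : LaxFunctor C D) : ∀ {a b : FreeBicategory C} {x y : OneCell a b},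
    Gen x y → (evalHom (evalApp F) x ⟶ evalHom (evalApp F) y)
  | _, _, _, _, .map₂ η => F.map₂ ((base C).map₂ η)
  | _, _, _, _, .map_id a => F.mapId (show C from a)
  | _, _, _, _, .map_comp _ _ => F.mapComp _ _

theorem evalHom₂_law (F : LaxFunctor C D) {a b : FreeBicategory C} {x y : OneCell a b}
    {η θ : Hom₂ Gen x y} (h : Law η θ) :
    evalHom₂ (evalApp F) (evalGen F) η = evalHom₂ (evalApp F) (evalGen F) θ := by
  cases h with
  | map₂_id f => exact F.map₂_id _
  | map₂_comp η θ =>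
    exact (congrArg F.map₂ ((base C).map₂_comp η θ)).trans (F.map₂_comp _ _)
  | map_comp_naturality_left η g =>
    induction η using Quot.ind
    exact F.mapComp_naturality_left _ _
  | map_comp_naturality_right f η =>
    induction η using Quot.ind
    exact F.mapComp_naturality_right _ _
  | map₂_associator => exact F.map₂_associator _ _ _
  | map₂_left_unitor => exact (F.map₂_leftUnitor_hom _).symm
  | map₂_right_unitor => exact (F.map₂_rightUnitor_hom _).symm

/-- The strict functor from the target of the free lax functor on the underlying graph of `C` to
`D` that is induced by a lax functor from `C` to `D`. -/
def eval (F : LaxFunctor C D) : StrictPseudofunctor (FreeLax C) D :=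
  evaluation (evalApp F) (evalGen F) (evalHom₂_law F)

/-- On the terms `F(w)`, the functor `eval F` takes the values of `F`. -/
theorem eval_map_app (F : LaxFunctor C D) {a b : FreeBicategory C} (w : a ⟶ b) :
    (eval F).map ((free C).map w) = F.map ((base C).map w) := rfl

theorem eval_map₂_map₂ (F : LaxFunctor C D) {a b : FreeBicategory C} {w w' : a ⟶ b}
    (η : w ⟶ w') :
    (eval F).map₂ ((free C).map₂ η) = F.map₂ ((base C).map₂ η) := rfl

theorem eval_map₂_mapId (F : LaxFunctor C D) (a : FreeBicategory C) :
    (eval F).map₂ ((free C).mapId a) = F.mapId (show C from a) := rfl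

theorem eval_map₂_mapComp (F : LaxFunctor C D) {a b c : FreeBicategory C} (w : a ⟶ b)
    (w' : b ⟶ c) :
    (eval F).map₂ ((free C).mapComp w w') = F.mapComp ((base C).map w) ((base C).map w') := rfl

/-- The functor `eval F` on the category of formal 1-cells and 2-cells from `a` to `b`. -/
def evalFunctor (F : LaxFunctor C D) (a b : C) :
    ((show FreeLax C from a) ⟶ (show FreeLax C from b)) ⥤ (F.obj a ⟶ F.obj b) :=
  (eval F).mapFunctor (show FreeLax C from a) (show FreeLax C from b)

/-- A diagram in `D` is a formal diagram of `F` that is expected to commute: it lifts to a diagram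
of formal 2-cells in which any two parallel composites have the same supporting map. -/
def ExpectedToCommute (F : LaxFunctor C D) {a b : C} {J : Type w} [Quiver.{w'} J]
    (X : J ⥤q (F.obj a ⟶ F.obj b)) : Prop :=
  ∃ L : J ⥤q ((show FreeLax C from a) ⟶ (show FreeLax C from b)),
    L ⋙q (evalFunctor F a b).toPrefunctor = X ∧
      ∀ ⦃i j : J⦄ (p q : Quiver.Path i j),
        supportHom ((Paths.lift L).map p) = supportHom ((Paths.lift L).map q)

end Formal

end FreeLax
/-! ### The free oplax functor on a graph -/

namespace FreeOplax

section Construction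

variable {G : Type u} [Quiver.{v} G]

/-- The generating 2-cells of the target of the free oplax functor: the images under `F` of the
2-cells of the free bicategory, the unit maps `F(1) ⟶ 1`, and the composition maps
`F(w w') ⟶ F(w) F(w')`. -/
inductive Gen : ∀ ⦃a b : FreeBicategory G⦄, OneCell a b → OneCell a b → Type max u v
  | map₂ {a b : FreeBicategory G} {f g : a ⟶ b} (η : f ⟶ g) : Gen (.app f) (.app g)
  | map_id (a : FreeBicategory G) : Gen (.app (𝟙 a)) (.unit a)
  | map_comp {a b c : FreeBicategory G} (f : a ⟶ b) (g : b ⟶ c) :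
      Gen (.app (f ≫ g)) ((OneCell.app f).comp (.app g))

local infixr:80 " ⬝ " => Hom₂.vcomp

/-- The relations between the generating 2-cells: the axioms of an oplax functor. -/
inductive Law : ∀ ⦃a b : FreeBicategory G⦄ ⦃x y : OneCell a b⦄,
    Hom₂ (@Gen G _) x y → Hom₂ (@Gen G _) x y → Prop
  | map₂_id {a b : FreeBicategory G} (f : a ⟶ b) : Law (.of (.map₂ (𝟙 f))) (.id (.app f))
  | map₂_comp {a b : FreeBicategory G} {f g h : a ⟶ b} (η : f ⟶ g) (θ : g ⟶ h) :
      Law (.of (.map₂ (η ≫ θ))) (.of (.map₂ η) ⬝ .of (.map₂ θ))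
  | map_comp_naturality_left {a b c : FreeBicategory G} {f f' : a ⟶ b} (η : f ⟶ f')
      (g : b ⟶ c) :
      Law (.of (.map₂ (η ▷ g)) ⬝ .of (.map_comp f' g))
        (.of (.map_comp f g) ⬝ .whisker_right (.app g) (.of (.map₂ η)))
  | map_comp_naturality_right {a b c : FreeBicategory G} (f : a ⟶ b) {g g' : b ⟶ c}
      (η : g ⟶ g') :
      Law (.of (.map₂ (f ◁ η)) ⬝ .of (.map_comp f g'))
        (.of (.map_comp f g) ⬝ .whisker_left (.app f) (.of (.map₂ η)))
  | map₂_associator {a b c d : FreeBicategory G} (f : a ⟶ b) (g : b ⟶ c) (h : c ⟶ d) :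
      Law (.of (.map₂ (α_ f g h).hom) ⬝ .of (.map_comp f (g ≫ h)) ⬝
          .whisker_left (.app f) (.of (.map_comp g h)))
        (.of (.map_comp (f ≫ g) h) ⬝ .whisker_right (.app h) (.of (.map_comp f g)) ⬝
          .associator (.app f) (.app g) (.app h))
  | map₂_left_unitor {a b : FreeBicategory G} (f : a ⟶ b) :
      Law (.of (.map₂ (λ_ f).hom))
        (.of (.map_comp (𝟙 a) f) ⬝ .whisker_right (.app f) (.of (.map_id a)) ⬝
          .left_unitor (.app f))
  | map₂_right_unitor {a b : FreeBicategory G} (f : a ⟶ b) :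
      Law (.of (.map₂ (ρ_ f).hom))
        (.of (.map_comp f (𝟙 b)) ⬝ .whisker_left (.app f) (.of (.map_id b)) ⬝
          .right_unitor (.app f))

end Construction

end FreeOplax

/-- The target of the free oplax functor on a graph. -/
abbrev FreeOplax (G : Type u) [Quiver.{v} G] : Type u := Presented (@FreeOplax.Law G _)

namespace FreeOplax

section Construction

variable {G : Type u} [Quiver.{v} G]

variable (G) in
/-- The free oplax functor on a graph, from the free bicategory on the graph. -/
def free : OplaxFunctor (FreeBicategory G) (FreeOplax G) where
  obj a := vertex Law a
  map w := app Law w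
  map₂ η := Quot.mk (Rel Law) (Hom₂.of (.map₂ η))
  map₂_id f := Quot.sound (.of (Law.map₂_id f))
  map₂_comp η θ := Quot.sound (.of (Law.map₂_comp η θ))
  mapId a := Quot.mk (Rel Law) (Hom₂.of (.map_id a))
  mapComp f g := Quot.mk (Rel Law) (Hom₂.of (.map_comp f g))
  mapComp_naturality_left η g := Quot.sound (.of (Law.map_comp_naturality_left η g))
  mapComp_naturality_right f _ _ η := Quot.sound (.of (Law.map_comp_naturality_right f η))
  map₂_associator f g h := Quot.sound (.of (Law.map₂_associator f g h))
  map₂_leftUnitor f := Quot.sound (.of (Law.map₂_left_unitor f))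
  map₂_rightUnitor f := Quot.sound (.of (Law.map₂_right_unitor f))

/-- The supporting map of a formal composite of generating 2-cells, in the direction opposite to
the 2-cell. Associators, unitors and 2-cells inside a term `F(...)` induce identity maps; expanded
instances of unit maps induce coface maps; expanded instances of composition maps induce codegeneracy
maps. -/
def supportHom₂ : ∀ {a b : FreeBicategory G} {x y : OneCell a b}, Hom₂ Gen x y → (Fin (y.terms) →o Fin (x.terms))
  | _, _, _, _, .id _ => OrderHom.id
  | _, _, _, _, .vcomp η θ => (supportHom₂ η).comp (supportHom₂ θ)
  | _, _, _, _, .whisker_left _ η => sumHom OrderHom.id (supportHom₂ η)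
  | _, _, _, _, .whisker_right _ η => sumHom (supportHom₂ η) OrderHom.id
  | _, _, _, _, .associator _ _ _ => castHom (Nat.add_assoc _ _ _).symm
  | _, _, _, _, .associator_inv _ _ _ => castHom (Nat.add_assoc _ _ _)
  | _, _, _, _, .right_unitor _ => castHom (Nat.add_zero _).symm
  | _, _, _, _, .right_unitor_inv _ => castHom (Nat.add_zero _)
  | _, _, _, _, .left_unitor _ => castHom (Nat.zero_add _).symm
  | _, _, _, _, .left_unitor_inv _ => castHom (Nat.zero_add _)
  | _, _, _, _, .of (.map₂ _) => (OrderHom.id : Fin 1 →o Fin 1)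
  | _, _, _, _, .of (.map_id _) => ⟨fun i : Fin 0 => i.elim0, fun i => i.elim0⟩
  | _, _, _, _, .of (.map_comp _ _) => ⟨fun _ => (0 : Fin 1), fun _ _ _ => le_rfl⟩

theorem edges_gen ⦃a b : FreeBicategory G⦄ ⦃x y : OneCell a b⦄ (η : Gen x y) :
    x.edges = y.edges := by
  cases η with
  | map₂ η => exact wordEdges_eq η
  | map_id => rfl
  | map_comp => rfl

theorem supportHom₂_congr {a b : FreeBicategory G} {x y : OneCell a b} {η θ : Hom₂ Gen x y}
    (h : Rel Law η θ) :
    supportHom₂ η = supportHom₂ θ := by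
  induction h with
  | vcomp_right η _ _ _ ih => exact congrArg (OrderHom.comp (supportHom₂ η) ·) ih
  | vcomp_left _ _ θ _ ih => exact congrArg (OrderHom.comp · (supportHom₂ θ)) ih
  | id_comp => rfl
  | comp_id => rfl
  | assoc => rfl
  | whisker_left f _ _ _ _ _ ih =>
    exact congrArg (sumHom (OrderHom.id : Fin (f.terms) →o Fin (f.terms)) ·) ih
  | whisker_right _ _ f _ _ _ ih =>
    exact congrArg (sumHom · (OrderHom.id : Fin (f.terms) →o Fin (f.terms))) ih
  | whisker_left_id => exact sumHom_id _ _
  | whisker_left_comp => exact sumHom_whisker_left _ _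
  | id_whisker_right => exact sumHom_id _ _
  | comp_whisker_right => exact sumHom_whisker_right _ _
  | id_whisker_left η => exact sumHom_empty_left _
  | comp_whisker_left => exact sumHom_assoc_left _
  | whisker_right_id => exact sumHom_empty_right _
  | whisker_right_comp => exact sumHom_assoc_right _
  | whisker_assoc => exact sumHom_assoc' _ _ _
  | whisker_exchange => exact (sumHom_exchange _ _).symm
  | associator_hom_inv => rfl
  | associator_inv_hom => rfl
  | left_unitor_hom_inv => rfl
  | left_unitor_inv_hom => rfl
  | right_unitor_hom_inv => rfl
  | right_unitor_inv_hom => rfl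
  | pentagon => exact sumHom_pentagon_inv _ _ _ _
  | triangle => exact sumHom_triangle_inv _ _
  | of h =>
    cases h with
    | map₂_id => rfl
    | map₂_comp => rfl
    | _ => exact OrderHom.ext _ _ (funext fun _ => Subsingleton.elim (α := Fin 1) _ _)

theorem supportHom₂_support {a b : FreeBicategory G} {x y : OneCell a b} (η : Hom₂ Gen x y) :
    (supportHom₂ η).comp y.support = x.support.comp (castHom (edges_eq₂ edges_gen η).symm) := by
  induction η with
  | id => rfl
  | vcomp η θ h h' =>
    change (supportHom₂ η).comp ((supportHom₂ θ).comp (OneCell.support _)) = _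
    rw [h']
    change ((supportHom₂ η).comp (OneCell.support _)).comp (castHom (edges_eq₂ edges_gen θ).symm) = _
    rw [h]
    rfl
  | whisker_left f η h => exact sumHom_square_left f.support _ _ _ _ h
  | whisker_right f η h => exact sumHom_square_right f.support _ _ _ _ h
  | associator f g h => exact sumHom_assoc_inv f.support g.support h.support
  | associator_inv f g h => exact sumHom_assoc f.support g.support h.support
  | right_unitor f => exact (congrArg (OrderHom.comp · (castHom (Nat.add_zero f.edges).symm))
      (sumHom_empty_right f.support).symm)
  | right_unitor_inv f => exact (congrArg (OrderHom.comp (castHom (Nat.add_zero f.terms)))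
      (sumHom_empty_right f.support))
  | left_unitor f => exact (congrArg (OrderHom.comp · (castHom (Nat.zero_add f.edges).symm))
      (sumHom_empty_left f.support).symm)
  | left_unitor_inv f => exact (congrArg (OrderHom.comp (castHom (Nat.zero_add f.terms)))
      (sumHom_empty_left f.support))
  | of η =>
    cases η with
    | map_id => exact OrderHom.ext _ _ (funext fun i : Fin 0 => i.elim0)
    | _ => exact OrderHom.ext _ _ (funext fun _ => Subsingleton.elim (α := Fin 1) _ _)

/-- The supporting map of a 2-cell, in the direction opposite to the 2-cell. -/
def supportHom {a b : FreeOplax G} {x y : a ⟶ b} (η : x ⟶ y) : Fin (terms y) →o Fin (terms x) :=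
  Quot.lift supportHom₂ (fun _ _ h => supportHom₂_congr h) η

theorem supportHom_comp {a b : FreeOplax G} {x y z : a ⟶ b} (η : x ⟶ y) (θ : y ⟶ z) :
    supportHom (η ≫ θ) = (supportHom η).comp (supportHom θ) := by
  induction η using Quot.ind with
  | mk η =>
    induction θ using Quot.ind with
    | mk θ => rfl

theorem supportHom_support {a b : FreeOplax G} {x y : a ⟶ b} (η : x ⟶ y) :
    (supportHom η).comp (support y) = (support x).comp (castHom (edges_eq edges_gen η).symm) := by
  induction η using Quot.ind with
  | mk η => exact supportHom₂_support η

/-- The supporting set functor, from the component of a 1-cell `W` with `n` edges to the opposite of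
the category of objects under `n` in `Δ`. -/
def supportFunctor {a b : FreeOplax G} (W : a ⟶ b) :
    (CategoryTheory.ConnectedComponents.mk W).Component ⥤ (Under (Delta.mk (edges W)))ᵒᵖ where
  obj x := Opposite.op (Under.mk (Y := Delta.mk (terms x.obj))
    ((support x.obj).comp (castHom (edges_eq_of_component edges_gen x.property))))
  map {x y} η := Quiver.Hom.op (Under.homMk (supportHom η.hom) (by
    change (supportHom η.hom).comp ((support y.obj).comp (castHom _)) = _
    rw [← OrderHom.comp_assoc, supportHom_support]
    rfl))
  map_id x := rfl
  map_comp η θ := by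
    apply Quiver.Hom.unop_inj
    apply Under.UnderMorphism.ext
    exact supportHom_comp η.hom θ.hom

end Construction

/-! ### Formal diagrams of oplax functors -/

section Formal

variable {C : Type u₁} [Bicategory.{w₁, v₁} C] {D : Type u₂} [Bicategory.{w₂, v₂} D]

/-- The value of the 1-cell `F(w)` in `D`. -/
def evalApp (F : OplaxFunctor C D) {a b : FreeBicategory C} (w : a ⟶ b) : F.obj a ⟶ F.obj b :=
  F.map ((base C).map w)

/-- The values of the generating 2-cells in `D`. -/
def evalGen (F : OplaxFunctor C D) : ∀ {a b : FreeBicategory C} {x y : OneCell a b},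
    Gen x y → (evalHom (evalApp F) x ⟶ evalHom (evalApp F) y)
  | _, _, _, _, .map₂ η => F.map₂ ((base C).map₂ η)
  | _, _, _, _, .map_id a => F.mapId (show C from a)
  | _, _, _, _, .map_comp _ _ => F.mapComp _ _

theorem evalHom₂_law (F : OplaxFunctor C D) {a b : FreeBicategory C} {x y : OneCell a b}
    {η θ : Hom₂ Gen x y} (h : Law η θ) :
    evalHom₂ (evalApp F) (evalGen F) η = evalHom₂ (evalApp F) (evalGen F) θ := by
  cases h with
  | map₂_id f => exact F.map₂_id _
  | map₂_comp η θ =>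
    exact (congrArg F.map₂ ((base C).map₂_comp η θ)).trans (F.map₂_comp _ _)
  | map_comp_naturality_left η g =>
    induction η using Quot.ind
    exact F.mapComp_naturality_left _ _
  | map_comp_naturality_right f η =>
    induction η using Quot.ind
    exact F.mapComp_naturality_right _ _
  | map₂_associator => exact F.map₂_associator _ _ _
  | map₂_left_unitor => exact F.map₂_leftUnitor _
  | map₂_right_unitor => exact F.map₂_rightUnitor _

/-- The strict functor from the target of the free oplax functor on the underlying graph of `C` to
`D` that is induced by an oplax functor from `C` to `D`. -/
def eval (F : OplaxFunctor C D) : StrictPseudofunctor (FreeOplax C) D :=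
  evaluation (evalApp F) (evalGen F) (evalHom₂_law F)

/-- On the terms `F(w)`, the functor `eval F` takes the values of `F`. -/
theorem eval_map_app (F : OplaxFunctor C D) {a b : FreeBicategory C} (w : a ⟶ b) :
    (eval F).map ((free C).map w) = F.map ((base C).map w) := rfl

theorem eval_map₂_map₂ (F : OplaxFunctor C D) {a b : FreeBicategory C} {w w' : a ⟶ b}
    (η : w ⟶ w') :
    (eval F).map₂ ((free C).map₂ η) = F.map₂ ((base C).map₂ η) := rfl

theorem eval_map₂_mapId (F : OplaxFunctor C D) (a : FreeBicategory C) :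
    (eval F).map₂ ((free C).mapId a) = F.mapId (show C from a) := rfl

theorem eval_map₂_mapComp (F : OplaxFunctor C D) {a b c : FreeBicategory C} (w : a ⟶ b)
    (w' : b ⟶ c) :
    (eval F).map₂ ((free C).mapComp w w') = F.mapComp ((base C).map w) ((base C).map w') := rfl

/-- The functor `eval F` on the category of formal 1-cells and 2-cells from `a` to `b`. -/
def evalFunctor (F : OplaxFunctor C D) (a b : C) :
    ((show FreeOplax C from a) ⟶ (show FreeOplax C from b)) ⥤ (F.obj a ⟶ F.obj b) :=
  (eval F).mapFunctor (show FreeOplax C from a) (show FreeOplax C from b)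

/-- A diagram in `D` is a formal diagram of `F` that is expected to commute: it lifts to a diagram
of formal 2-cells in which any two parallel composites have the same supporting map. -/
def ExpectedToCommute (F : OplaxFunctor C D) {a b : C} {J : Type w} [Quiver.{w'} J]
    (X : J ⥤q (F.obj a ⟶ F.obj b)) : Prop :=
  ∃ L : J ⥤q ((show FreeOplax C from a) ⟶ (show FreeOplax C from b)),
    L ⋙q (evalFunctor F a b).toPrefunctor = X ∧
      ∀ ⦃i j : J⦄ (p q : Quiver.Path i j),
        supportHom ((Paths.lift L).map p) = supportHom ((Paths.lift L).map q)

end Formal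

end FreeOplax
/-! ### Monoidal categories as bicategories with one 0-cell -/

section Monoidal

variable {C : Type u₁} [Category.{v₁} C] [MonoidalCategory C]
variable {D : Type u₂} [Category.{v₂} D] [MonoidalCategory D]

/-- A lax monoidal functor as a lax functor of bicategories with one 0-cell. -/
def laxOfMonoidal (F : C ⥤ D) [F.LaxMonoidal] :
    LaxFunctor (MonoidalSingleObj C) (MonoidalSingleObj D) where
  obj _ := MonoidalSingleObj.star D
  map X := F.obj X
  map₂ f := F.map f
  map₂_id X := F.map_id X
  map₂_comp f g := F.map_comp f g
  mapId _ := Functor.LaxMonoidal.ε F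
  mapComp X Y := Functor.LaxMonoidal.μ F X Y
  mapComp_naturality_left f Y := (Functor.LaxMonoidal.μ_natural_left F f Y).symm
  mapComp_naturality_right X _ _ f := (Functor.LaxMonoidal.μ_natural_right F X f).symm
  map₂_associator X Y Z := Functor.LaxMonoidal.associativity F X Y Z
  map₂_leftUnitor X := (Functor.LaxMonoidal.left_unitality_inv F X).symm
  map₂_rightUnitor X := (Functor.LaxMonoidal.right_unitality_inv F X).symm

/-- An oplax monoidal functor as an oplax functor of bicategories with one 0-cell. -/
def oplaxOfMonoidal (F : C ⥤ D) [F.OplaxMonoidal] :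
    OplaxFunctor (MonoidalSingleObj C) (MonoidalSingleObj D) where
  obj _ := MonoidalSingleObj.star D
  map X := F.obj X
  map₂ f := F.map f
  map₂_id X := F.map_id X
  map₂_comp f g := F.map_comp f g
  mapId _ := Functor.OplaxMonoidal.η F
  mapComp X Y := Functor.OplaxMonoidal.δ F X Y
  mapComp_naturality_left f Y := (Functor.OplaxMonoidal.δ_natural_left F f Y).symm
  mapComp_naturality_right X _ _ f := (Functor.OplaxMonoidal.δ_natural_right F X f).symm
  map₂_associator X Y Z := (Functor.OplaxMonoidal.associativity F X Y Z).symm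
  map₂_leftUnitor X := (Functor.OplaxMonoidal.left_unitality_hom F X).symm
  map₂_rightUnitor X := (Functor.OplaxMonoidal.right_unitality_hom F X).symm

/-- A diagram in `D` is a formal diagram of the lax monoidal functor `F` that is expected to
commute. -/
def LaxMonoidalExpectedToCommute (F : C ⥤ D) [F.LaxMonoidal] {J : Type w} [Quiver.{w'} J]
    (X : J ⥤q D) : Prop :=
  FreeLax.ExpectedToCommute (laxOfMonoidal F) (a := MonoidalSingleObj.star C)
    (b := MonoidalSingleObj.star C) X

/-- A diagram in `D` is a formal diagram of the oplax monoidal functor `F` that is expected to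
commute. -/
def OplaxMonoidalExpectedToCommute (F : C ⥤ D) [F.OplaxMonoidal] {J : Type w} [Quiver.{w'} J]
    (X : J ⥤q D) : Prop :=
  FreeOplax.ExpectedToCommute (oplaxOfMonoidal F) (a := MonoidalSingleObj.star C)
    (b := MonoidalSingleObj.star C) X

end Monoidal

end LaxCoherence

/-! The core is faithfulness and fullness of the supporting map on 2-cells of the free lax target: a
2-cell is determined by its supporting map, and every compatible monotone map between the terms of
two 1-cells with the same underlying path of edges occurs.

Up to associators and unitors a 1-cell is a list `F(w₁) ⋯ F(wₙ)`, bracketed to the left. Between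
lists there is a class of 2-cells in normal form, `Canonical`. Each target term is created by a unit
map (`extend`) and then swallows the source terms of its fibre one after another, from left to right
(`absorb`). Normal forms are not reached by rewriting. Instead, precomposition with each generating
2-cell is shown to preserve the class. The lax functor axioms are what this needs: naturality of the
composition maps for 2-cells inside a term, right unitality for unit maps, associativity for
composition maps, and left unitality to see that identities are canonical. Conjugation with the
isomorphisms `appendIso` turns associators and unitors into identities and reduces whiskering to the
action on lists, so every 2-cell has a canonical normalization (`canonical_normal`).

The supporting map determines a canonical 2-cell step by step (`eq_of_canonical`): the last target
term is hit by the last source term if the last step is `absorb`, and is missed if it is `extend`.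
The 2-cells inside the terms add no freedom, because the free bicategory is locally thin. The same
case distinction, read as a construction, gives fullness (`exists_list_supportHom_eq`).

The connected component of a 1-cell consists of the 1-cells with the same underlying path. Cutting
this path into consecutive pieces realizes every monotone map out of its edges, which is essential
surjectivity. Faithfulness alone yields the statements on formal diagrams: parallel composites of a
lift with equal supporting maps are already equal in the free target, and a functor carries this
equality to `D`.

The oplax case follows from the lax one. All 2-cells of the free bicategory are invertible, so
reversing 2-cells while keeping the 1-cells identifies the two free targets locally, up to passing
to opposite categories, and respects supporting maps. -/

namespace LaxCoherence

/-! ### Words and paths -/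

section WordPath

variable {G : Type u} [Quiver.{v} G]

/-- The path of edges that underlies a 1-cell of the free bicategory. -/
def wordPath {a b : FreeBicategory G} (w : a ⟶ b) : @Quiver.Path G _ a b :=
  FreeBicategory.normalizeAux Quiver.Path.nil w

theorem wordPath_comp {a b c : FreeBicategory G} (f : a ⟶ b) (g : b ⟶ c) :
    wordPath (f ≫ g) = (wordPath f).comp (wordPath g) :=
  FreeBicategory.normalizeAux_nil_comp f g

theorem wordPath_congr {a b : FreeBicategory G} {f g : a ⟶ b} (η : f ⟶ g) :
    wordPath f = wordPath g :=
  FreeBicategory.normalizeAux_congr Quiver.Path.nil η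

theorem length_wordPath : ∀ {a b : FreeBicategory G} (w : a ⟶ b),
    (wordPath w).length = wordEdges w
  | _, _, FreeBicategory.Hom.of _ => rfl
  | _, _, FreeBicategory.Hom.id _ => rfl
  | _, _, FreeBicategory.Hom.comp f g => by
    refine (congrArg (Quiver.Path.length (V := G)) (wordPath_comp f g)).trans ?_
    rw [Quiver.Path.length_comp, length_wordPath f, length_wordPath g]
    rfl

/-- The left-normalized word of a path. -/
def pathWord {a b : FreeBicategory G} (p : @Quiver.Path G _ a b) : a ⟶ b :=
  FreeBicategory.inclusionPathAux p

/-- Every word is isomorphic to the left-normalized word of its path. -/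
def wordIso {a b : FreeBicategory G} (w : a ⟶ b) : w ≅ pathWord (wordPath w) :=
  (FreeBicategory.normalizeUnitIso a b).app w

theorem wordPath_pathWord {a b : FreeBicategory G} (p : @Quiver.Path G _ a b) :
    wordPath (pathWord p) = p := by
  induction p with
  | nil => rfl
  | cons p e ih => exact congrArg (fun q => Quiver.Path.cons (V := G) q e) ih

/-- Both words are isomorphic to the left-normalized word of their common path. With
`wordPath_congr`, parallel words are linked by a 2-cell exactly if they have the same edges. -/
theorem nonempty_iso_of_wordPath_eq {a b : FreeBicategory G} {f g : a ⟶ b}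
    (h : wordPath f = wordPath g) : Nonempty (f ≅ g) :=
  ⟨wordIso f ≪≫ eqToIso (congrArg pathWord h) ≪≫ (wordIso g).symm⟩

/-- The inverse of a 2-cell of the free bicategory. -/
noncomputable def wordInv {a b : FreeBicategory G} {f g : a ⟶ b} (η : f ⟶ g) : g ⟶ f :=
  (nonempty_iso_of_wordPath_eq (wordPath_congr η)).some.inv

end WordPath

/-! ### Canonical 2-cells between lists of values of a lax functor -/

section Lists

variable {B : Type u₁} [Bicategory.{w₁, v₁} B] {D : Type u₂} [Bicategory.{w₂, v₂} D]
  (F : LaxFunctor B D)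

open Quiver (Path)

/-- The left-normalized composite of the values of a lax functor on a list of 1-cells. -/
def listMap {a : B} : ∀ {b : B}, Path a b → (F.obj a ⟶ F.obj b)
  | _, .nil => 𝟙 _
  | _, .cons p w => listMap p ≫ F.map w

variable {F}

/-- Append a new last term to the target of a 2-cell. -/
def extend {x : D} {b : B} {X Y : x ⟶ F.obj b} (f : X ⟶ Y) {v : b ⟶ b} (θ : 𝟙 b ⟶ v) :
    X ⟶ Y ≫ F.map v :=
  f ≫ (ρ_ Y).inv ≫ Y ◁ (F.mapId b ≫ F.map₂ θ)

/-- Append a new last term to the source of a 2-cell and compose it with the last term of the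
target. -/
def absorb {x : D} {b c d : B} {X : x ⟶ F.obj b} {Y : x ⟶ F.obj c} {v : c ⟶ b}
    (f : X ⟶ Y ≫ F.map v) {w : b ⟶ d} {v' : c ⟶ d} (θ : v ≫ w ⟶ v') :
    X ≫ F.map w ⟶ Y ≫ F.map v' :=
  f ▷ F.map w ≫ (α_ _ _ _).hom ≫ Y ◁ (F.mapComp v w ≫ F.map₂ θ)

/-! ### Extension and absorption against the structure 2-cells of a lax functor -/

section

variable {x : D} {b c d e : B}

theorem extend_map₂ {X Y : x ⟶ F.obj b} (f : X ⟶ Y) {v v' : b ⟶ b} (θ : 𝟙 b ⟶ v) (κ : v ⟶ v') :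
    extend f θ ≫ Y ◁ F.map₂ κ = extend f (θ ≫ κ) := by
  simp [extend]

theorem comp_extend {W X Y : x ⟶ F.obj b} (g : W ⟶ X) (f : X ⟶ Y) {v : b ⟶ b} (θ : 𝟙 b ⟶ v) :
    g ≫ extend f θ = extend (g ≫ f) θ := by
  simp [extend]

variable {X : x ⟶ F.obj b} {Y : x ⟶ F.obj c} {v : c ⟶ b}

theorem absorb_map₂ (f : X ⟶ Y ≫ F.map v) {w : b ⟶ d} {v' v'' : c ⟶ d} (θ : v ≫ w ⟶ v')
    (κ : v' ⟶ v'') :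
    absorb f θ ≫ Y ◁ F.map₂ κ = absorb f (θ ≫ κ) := by
  simp [absorb]

theorem whiskerRight_comp_absorb {W : x ⟶ F.obj b} (g : W ⟶ X) (f : X ⟶ Y ≫ F.map v) {w : b ⟶ d}
    {v' : c ⟶ d} (θ : v ≫ w ⟶ v') :
    g ▷ F.map w ≫ absorb f θ = absorb (g ≫ f) θ := by
  simp [absorb]

/-- Naturality of the composition map in its left variable. It allows the intermediate 1-cell `v` to
be exchanged for an isomorphic one. -/
theorem map₂_absorb (f : X ⟶ Y ≫ F.map v) {v₁ : c ⟶ b} (κ : v ⟶ v₁) {w : b ⟶ d} {v' : c ⟶ d}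
    (θ : v₁ ≫ w ⟶ v') :
    absorb (f ≫ Y ◁ F.map₂ κ) θ = absorb f (κ ▷ w ≫ θ) := by
  simp only [absorb, comp_whiskerRight, Category.assoc, whisker_assoc, Iso.inv_hom_id_assoc,
    F.map₂_comp, ← whiskerLeft_comp]
  rw [F.mapComp_naturality_left_assoc]

/-- Naturality of the composition map in its right variable: a 2-cell inside the absorbed term is
taken up by `θ`. -/
theorem whisker_absorb (f : X ⟶ Y ≫ F.map v) {w w₁ : b ⟶ d} (κ : w₁ ⟶ w) {v' : c ⟶ d}
    (θ : v ≫ w ⟶ v') :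
    X ◁ F.map₂ κ ≫ absorb f θ = absorb f (v ◁ κ ≫ θ) := by
  simp only [absorb, F.map₂_comp, F.mapComp_naturality_right_assoc]
  rw [whisker_exchange_assoc]
  simp

/-- Right unitality: absorbing a freshly created unit term only changes the last target term by a
2-cell of `B`. -/
theorem unit_absorb (f : X ⟶ Y ≫ F.map v) {v' : c ⟶ b} (θ : v ≫ 𝟙 b ⟶ v') :
    ((ρ_ X).inv ≫ X ◁ F.mapId b) ≫ absorb f θ = f ≫ Y ◁ F.map₂ ((ρ_ v).inv ≫ θ) := by
  simp only [absorb, Category.assoc]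
  rw [whisker_exchange_assoc, F.map₂_comp, F.map₂_rightUnitor]
  simp

/-- Associativity: absorbing a composite amounts to absorbing its two factors in turn. -/
theorem comp_absorb (f : X ⟶ Y ≫ F.map v) {w : b ⟶ d} {w' : d ⟶ e} {v' : c ⟶ e}
    (θ : v ≫ (w ≫ w') ⟶ v') :
    ((α_ X (F.map w) (F.map w')).hom ≫ X ◁ F.mapComp w w') ≫ absorb f θ =
      absorb (absorb f (𝟙 (v ≫ w))) ((α_ v w w').hom ≫ θ) := by
  simp only [absorb, Category.assoc]
  rw [whisker_exchange_assoc]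
  simp only [F.map₂_comp, F.map₂_id, Category.comp_id, comp_whiskerRight, Category.assoc,
    whisker_assoc, Iso.inv_hom_id_assoc]
  have := F.map₂_associator v w w'
  simp only [← whiskerLeft_comp]
  rw [reassoc_of% this]
  simp

/-- Left unitality: a term absorbed by a freshly created unit term is carried along unchanged. -/
theorem absorb_extend {X Y : x ⟶ F.obj b} (f : X ⟶ Y) (w : b ⟶ d) :
    absorb (extend f (𝟙 (𝟙 b))) (λ_ w).hom = f ▷ F.map w := by
  have := F.map₂_leftUnitor_hom w
  simp only [absorb, extend, F.map₂_id, Category.comp_id, comp_whiskerRight, Category.assoc,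
    whisker_assoc, Iso.inv_hom_id_assoc, ← whiskerLeft_comp]
  rw [← this]
  simp

end

variable (F) in
/-- The 2-cells between lists that arise by extending and absorbing. -/
inductive Canonical {a : B} : ∀ {b : B} (p q : Path a b), (listMap F p ⟶ listMap F q) → Prop
  | nil : Canonical .nil .nil (𝟙 _)
  | extend {b : B} {p q : Path a b} {f : listMap F p ⟶ listMap F q} {v : b ⟶ b}
      (θ : 𝟙 b ⟶ v) (h : Canonical p q f) : Canonical p (q.cons v) (extend f θ)
  | absorb {b c d : B} {p : Path a b} {q : Path a c} {v : c ⟶ b}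
      {f : listMap F p ⟶ listMap F q ≫ F.map v} {w : b ⟶ d} {v' : c ⟶ d} (θ : v ≫ w ⟶ v')
      (h : Canonical p (q.cons v) f) : Canonical (p.cons w) (q.cons v') (absorb f θ)

namespace Canonical

variable {a : B}

theorem id : ∀ {b : B} (p : Path a b), Canonical F p p (𝟙 (listMap F p))
  | _, .nil => nil
  | _, .cons p w => by
    -- The last term of the list is absorbed by a unit term created for this purpose.
    have := ((id p).extend (𝟙 _)).absorb (λ_ w).hom
    rwa [absorb_extend, id_whiskerRight] at this

/-- Both constructors with nonempty target carry a free 2-cell `θ` of `B` into the last term, and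
`κ` is composed into it. -/
theorem map₂ {b c : B} {p : Path a c} {q : Path a b} {v v' : b ⟶ c}
    {f : listMap F p ⟶ listMap F q ≫ F.map v} (h : Canonical F p (q.cons v) f) (κ : v ⟶ v') :
    Canonical F p (q.cons v') (f ≫ listMap F q ◁ F.map₂ κ) := by
  cases h with
  | extend θ h => exact (congrArg (Canonical F _ _) (extend_map₂ _ _ _)).mpr (h.extend _)
  | absorb θ h => exact (congrArg (Canonical F _ _) (absorb_map₂ _ _ _)).mpr (h.absorb _)

end Canonical

/-- Precomposition with a given 2-cell between lists preserves canonical 2-cells. -/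
def PreservesCanonical {a b : B} {p p' : Path a b} (φ : listMap F p ⟶ listMap F p') : Prop :=
  ∀ ⦃q : Path a b⦄ ⦃f : listMap F p' ⟶ listMap F q⦄, Canonical F p' q f → Canonical F p q (φ ≫ f)

namespace PreservesCanonical

variable {a b c : B}

/-- Identities are canonical, so stability under precomposition is the stronger property. Unlike
being canonical, it is visibly closed under composition. -/
theorem canonical {p p' : Path a b} {φ : listMap F p ⟶ listMap F p'} (h : PreservesCanonical φ) :
    Canonical F p p' φ := by
  simpa using h (.id p')

theorem id (p : Path a b) : PreservesCanonical (𝟙 (listMap F p)) := fun q f h => by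
  simpa using h

theorem comp {p p' p'' : Path a b} {φ : listMap F p ⟶ listMap F p'}
    {ψ : listMap F p' ⟶ listMap F p''} (h : PreservesCanonical φ) (h' : PreservesCanonical ψ) :
    PreservesCanonical (φ ≫ ψ) := fun q f k => by
  simpa using h (h' k)

/-- A canonical 2-cell out of `p'.cons w` is an absorption of `w` followed by finitely many
extensions, and extensions commute with precomposition. The induction on the length of the target
strips off these extensions. -/
theorem of_absorb_aux (n : ℕ) : ∀ {b : B} {p q : Path a b} {p' : Path a c} {w : c ⟶ b}
    {φ : listMap F p ⟶ listMap F p' ≫ F.map w}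
    (_ : ∀ ⦃d : B⦄ ⦃q : Path a d⦄ ⦃v : d ⟶ c⦄ ⦃v' : d ⟶ b⦄
      ⦃f : listMap F p' ⟶ listMap F q ≫ F.map v⦄ (θ : v ≫ w ⟶ v'),
      Canonical F p' (q.cons v) f → Canonical F p (q.cons v') (φ ≫ absorb f θ))
    {f : listMap F p' ≫ F.map w ⟶ listMap F q} (_ : q.length = n),
    Canonical F (p'.cons w) q f → Canonical F p q (φ ≫ f) := by
  induction n with
  | zero =>
    intro b p q p' w φ H f hq h
    cases h <;> exact absurd hq (Nat.succ_ne_zero _)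
  | succ n ih =>
    intro b p q p' w φ H f hq h
    cases h with
    | extend θ h =>
      exact (congrArg (Canonical F _ _) (comp_extend φ _ θ)).mpr
        ((ih H (Nat.succ.inj hq) h).extend θ)
    | absorb θ h => exact H θ h

/-- It suffices to treat the canonical 2-cells that absorb the last term of the source. -/
theorem of_absorb {p : Path a b} {p' : Path a c} {w : c ⟶ b}
    {φ : listMap F p ⟶ listMap F p' ≫ F.map w}
    (H : ∀ ⦃d : B⦄ ⦃q : Path a d⦄ ⦃v : d ⟶ c⦄ ⦃v' : d ⟶ b⦄
      ⦃f : listMap F p' ⟶ listMap F q ≫ F.map v⦄ (θ : v ≫ w ⟶ v'),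
      Canonical F p' (q.cons v) f → Canonical F p (q.cons v') (φ ≫ absorb f θ)) :
    PreservesCanonical (p' := p'.cons w) φ :=
  fun _ _ h => of_absorb_aux _ H rfl h

theorem whiskerRight {p p' : Path a b} {φ : listMap F p ⟶ listMap F p'}
    (h : PreservesCanonical φ) (w : b ⟶ c) :
    PreservesCanonical (p := p.cons w) (p' := p'.cons w) (φ ▷ F.map w) :=
  of_absorb fun _ _ _ _ f θ k =>
    (congrArg (Canonical F _ _) (whiskerRight_comp_absorb φ f θ)).mpr ((h k).absorb θ)

theorem map₂ (p : Path a b) {w w' : b ⟶ c} (κ : w ⟶ w') :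
    PreservesCanonical (p := p.cons w) (p' := p.cons w') (listMap F p ◁ F.map₂ κ) :=
  of_absorb fun _ _ _ _ f θ k =>
    (congrArg (Canonical F _ _) (whisker_absorb f κ θ)).mpr (k.absorb _)

theorem mapId (p : Path a b) :
    PreservesCanonical (p := p) (p' := p.cons (𝟙 b))
      ((ρ_ (listMap F p)).inv ≫ listMap F p ◁ F.mapId b) :=
  of_absorb fun _ _ _ _ f θ k =>
    (congrArg (Canonical F _ _) (unit_absorb f θ)).mpr (k.map₂ _)

theorem mapComp {d : B} (p : Path a b) (w : b ⟶ c) (w' : c ⟶ d) :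
    PreservesCanonical (p := (p.cons w).cons w') (p' := p.cons (w ≫ w'))
      ((α_ (listMap F p) (F.map w) (F.map w')).hom ≫ listMap F p ◁ F.mapComp w w') :=
  of_absorb fun _ _ _ _ f θ k =>
    (congrArg (Canonical F _ _) (comp_absorb f θ)).mpr ((k.absorb _).absorb _)

end PreservesCanonical

end Lists
/-! ### Conjugation of 2-cells in a bicategory -/

section Conjugation

variable {D : Type u} [Bicategory.{w, v} D] {x y z t s : D} {P : x ⟶ y}

/-- Composition of isomorphisms `P X ≅ Q` and `Q Y ≅ R` to an isomorphism `P (X Y) ≅ R`. -/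
def pasteIso {X : y ⟶ z} {Q : x ⟶ z} {Y : z ⟶ t} {R : x ⟶ t} (e : P ≫ X ≅ Q) (f : Q ≫ Y ≅ R) :
    P ≫ X ≫ Y ≅ R :=
  (α_ P X Y).symm ≪≫ whiskerRightIso e Y ≪≫ f

/-- The 2-cell `Q ⟶ Q'` that corresponds to a 2-cell `X ⟶ X'`. -/
def conjLeft {X X' : y ⟶ z} {Q Q' : x ⟶ z} (e : P ≫ X ≅ Q) (e' : P ≫ X' ≅ Q') (η : X ⟶ X') :
    Q ⟶ Q' :=
  e.inv ≫ P ◁ η ≫ e'.hom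

/-- The 2-cell `Q ⟶ Q'` that corresponds to a 2-cell `P ⟶ P'`. -/
def conjRight {P' : x ⟶ y} {X : y ⟶ z} {Q Q' : x ⟶ z} (e : P ≫ X ≅ Q) (e' : P' ≫ X ≅ Q')
    (φ : P ⟶ P') : Q ⟶ Q' :=
  e.inv ≫ φ ▷ X ≫ e'.hom

variable {X X' X'' : y ⟶ z} {Q Q' Q'' : x ⟶ z} {Y Y' : z ⟶ t} {R R' : x ⟶ t}

theorem conjLeft_id (e : P ≫ X ≅ Q) : conjLeft e e (𝟙 X) = 𝟙 Q := by
  simp [conjLeft]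

theorem conjLeft_comp (e : P ≫ X ≅ Q) (e' : P ≫ X' ≅ Q') (e'' : P ≫ X'' ≅ Q'') (η : X ⟶ X')
    (θ : X' ⟶ X'') : conjLeft e e'' (η ≫ θ) = conjLeft e e' η ≫ conjLeft e' e'' θ := by
  simp [conjLeft]

/-- By the interchange law, the whiskering 1-cell `X` disappears into the prefix, which grows from
`P` to `Q`. -/
theorem conjLeft_whiskerLeft (e : P ≫ X ≅ Q) (f : Q ≫ Y ≅ R) (f' : Q ≫ Y' ≅ R') (η : Y ⟶ Y') :
    conjLeft (pasteIso e f) (pasteIso e f') (X ◁ η) = conjLeft f f' η := by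
  simp only [conjLeft, pasteIso, Iso.trans_inv, Iso.trans_hom, Iso.symm_inv, Iso.symm_hom,
    whiskerRightIso_inv, whiskerRightIso_hom, Category.assoc]
  rw [associator_inv_naturality_right_assoc, Iso.hom_inv_id_assoc, whisker_exchange_assoc,
    inv_hom_whiskerRight_assoc]

/-- Seen from `Y`, the 2-cell changes the prefix; hence the passage to `conjRight`. -/
theorem conjLeft_whiskerRight (e : P ≫ X ≅ Q) (e' : P ≫ X' ≅ Q') (f : Q ≫ Y ≅ R)
    (f' : Q' ≫ Y ≅ R') (η : X ⟶ X') :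
    conjLeft (pasteIso e f) (pasteIso e' f') (η ▷ Y) = conjRight f f' (conjLeft e e' η) := by
  simp [conjLeft, conjRight, pasteIso]

theorem conjRight_paste {P' : x ⟶ y} (e : P ≫ X ≅ Q) (e' : P' ≫ X ≅ Q') (f : Q ≫ Y ≅ R)
    (f' : Q' ≫ Y ≅ R') (φ : P ⟶ P') :
    conjRight (pasteIso e f) (pasteIso e' f') φ = conjRight f f' (conjRight e e' φ) := by
  simp [conjRight, pasteIso]

/-- Both bracketings attach `X`, `Y`, `Z` to `P` one at a time by the same isomorphisms; the
associators that remain cancel by the pentagon. -/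
theorem conjLeft_associator {Z : t ⟶ s} {T : x ⟶ s} (e : P ≫ X ≅ Q) (f : Q ≫ Y ≅ R)
    (g : R ≫ Z ≅ T) :
    conjLeft (pasteIso (pasteIso e f) g) (pasteIso e (pasteIso f g)) (α_ X Y Z).hom = 𝟙 T := by
  unfold conjLeft
  rw [Iso.inv_comp_eq]
  simp [pasteIso]

theorem conjLeft_associator_inv {Z : t ⟶ s} {T : x ⟶ s} (e : P ≫ X ≅ Q) (f : Q ≫ Y ≅ R)
    (g : R ≫ Z ≅ T) :
    conjLeft (pasteIso e (pasteIso f g)) (pasteIso (pasteIso e f) g) (α_ X Y Z).inv = 𝟙 T := by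
  have := conjLeft_comp (pasteIso e (pasteIso f g)) (pasteIso (pasteIso e f) g)
    (pasteIso e (pasteIso f g)) (α_ X Y Z).inv (α_ X Y Z).hom
  rwa [conjLeft_associator, Iso.inv_hom_id, conjLeft_id, Category.comp_id, eq_comm] at this

theorem conjLeft_rightUnitor (e : P ≫ X ≅ Q) :
    conjLeft (pasteIso e (ρ_ Q)) e (ρ_ X).hom = 𝟙 Q := by
  unfold conjLeft
  rw [Iso.inv_comp_eq]
  simp [pasteIso]

theorem conjLeft_rightUnitor_inv (e : P ≫ X ≅ Q) :
    conjLeft e (pasteIso e (ρ_ Q)) (ρ_ X).inv = 𝟙 Q := by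
  have := conjLeft_comp e (pasteIso e (ρ_ Q)) e (ρ_ X).inv (ρ_ X).hom
  rwa [conjLeft_rightUnitor, Iso.inv_hom_id, conjLeft_id, Category.comp_id, eq_comm] at this

theorem conjLeft_leftUnitor (e : P ≫ X ≅ Q) :
    conjLeft (pasteIso (ρ_ P) e) e (λ_ X).hom = 𝟙 Q := by
  unfold conjLeft
  rw [Iso.inv_comp_eq]
  simp [pasteIso]

theorem conjLeft_leftUnitor_inv (e : P ≫ X ≅ Q) :
    conjLeft e (pasteIso (ρ_ P) e) (λ_ X).inv = 𝟙 Q := by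
  have := conjLeft_comp e (pasteIso (ρ_ P) e) e (λ_ X).inv (λ_ X).hom
  rwa [conjLeft_leftUnitor, Iso.inv_hom_id, conjLeft_id, Category.comp_id, eq_comm] at this

theorem conjLeft_paste_refl {W : y ⟶ t} (η : X ≫ Y ⟶ W) :
    conjLeft (pasteIso (Iso.refl (P ≫ X)) (Iso.refl _)) (Iso.refl (P ≫ W)) η =
      (α_ P X Y).hom ≫ P ◁ η := by
  simp [conjLeft, pasteIso]

end Conjugation

namespace FreeLax

open Quiver (Path)

/-! ### Normalization of 1-cells and 2-cells -/

section Normalization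

variable {G : Type u} [Quiver.{v} G]

/-- A formal 1-cell as a 1-cell of the target of the free lax functor. -/
def cell {a b : FreeBicategory G} (x : OneCell a b) : (free G).obj a ⟶ (free G).obj b := x

/-- Append the terms of a 1-cell to a list of words. -/
def append {a : FreeBicategory G} : ∀ {b c : FreeBicategory G}, Path a b → OneCell b c → Path a c
  | _, _, p, .app w => p.cons w
  | _, _, p, .unit _ => p
  | _, _, p, .comp x y => append (append p x) y

/-- Appending the terms of a 1-cell to a list is composition with this 1-cell, up to isomorphism. -/
def appendIso {a : FreeBicategory G} : ∀ {b c : FreeBicategory G} (p : Path a b) (x : OneCell b c),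
    listMap (free G) p ≫ cell x ≅ listMap (free G) (append p x)
  | _, _, _, .app _ => Iso.refl _
  | _, _, p, .unit _ => ρ_ (listMap (free G) p)
  | _, _, p, .comp x y => pasteIso (Y := cell y) (appendIso p x) (appendIso (append p x) y)

variable {a b c : FreeBicategory G}

/-- The 2-cell between lists that corresponds to a 2-cell. -/
def normal (p : Path a b) {x y : OneCell b c} (η : cell x ⟶ cell y) :
    listMap (free G) (append p x) ⟶ listMap (free G) (append p y) :=
  conjLeft (appendIso p x) (appendIso p y) η

/-- Append the terms of a 1-cell to the source and the target of a 2-cell between lists. -/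
def appendRight {p p' : Path a b} (φ : listMap (free G) p ⟶ listMap (free G) p') (x : OneCell b c) :
    listMap (free G) (append p x) ⟶ listMap (free G) (append p' x) :=
  conjRight (appendIso p x) (appendIso p' x) φ

/-- Whiskering with a 1-cell is, on lists, whiskering with its terms one at a time, and formal units
have no effect. -/
theorem preservesCanonical_appendRight : ∀ {b c : FreeBicategory G} (x : OneCell b c)
    {p p' : Path a b} {φ : listMap (free G) p ⟶ listMap (free G) p'} (_ : PreservesCanonical φ),
    PreservesCanonical (appendRight φ x)
  | _, _, .app w, _, _, φ, h => by
    have : appendRight φ (.app w) = φ ▷ (free G).map w :=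
      (Category.id_comp _).trans (Category.comp_id _)
    exact this ▸ h.whiskerRight w
  | _, _, .unit a, p, p', φ, h => by
    have : appendRight φ (.unit a) = φ :=
      (congrArg ((ρ_ (listMap (free G) p)).inv ≫ ·) (rightUnitor_naturality φ)).trans
        (Iso.inv_hom_id_assoc _ _)
    exact (congrArg PreservesCanonical this).mpr h
  | _, _, .comp x y, _, _, φ, h =>
    (congrArg PreservesCanonical (conjRight_paste _ _ _ _ φ)).mpr
      (preservesCanonical_appendRight y (preservesCanonical_appendRight x h))

/-- All 2-cells between lists that arise from 2-cells by normalization preserve canonical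
2-cells. -/
theorem preservesCanonical_normal {x y : OneCell b c} (η : Hom₂ Gen x y) : ∀ p : Path a b,
    PreservesCanonical (normal p (Quot.mk (Rel Law) η : cell x ⟶ cell y)) := by
  induction η with
  | id x => exact fun p => (congrArg PreservesCanonical (conjLeft_id (appendIso p x))).mpr (.id _)
  | vcomp η θ h h' =>
    exact fun p => (congrArg PreservesCanonical (conjLeft_comp _ (appendIso p _) _
      (Quot.mk (Rel Law) η : cell _ ⟶ cell _) (Quot.mk (Rel Law) θ : cell _ ⟶ cell _))).mpr
      ((h p).comp (h' p))
  | whisker_left f η h =>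
    -- The terms of `f` join the prefix, which is why the induction ranges over all prefixes.
    exact fun p => (congrArg PreservesCanonical (conjLeft_whiskerLeft (appendIso p f) _ _
      (Quot.mk (Rel Law) η : cell _ ⟶ cell _))).mpr (h _)
  | whisker_right f η h =>
    exact fun p => (congrArg PreservesCanonical (conjLeft_whiskerRight (appendIso p _)
      (appendIso p _) (appendIso _ f) (appendIso _ f)
      (Quot.mk (Rel Law) η : cell _ ⟶ cell _))).mpr (preservesCanonical_appendRight f (h p))
  | associator f g h =>
    exact fun p => (congrArg PreservesCanonical
      (conjLeft_associator (appendIso p f) (appendIso _ g) (appendIso _ h))).mpr (.id _)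
  | associator_inv f g h =>
    exact fun p => (congrArg PreservesCanonical
      (conjLeft_associator_inv (appendIso p f) (appendIso _ g) (appendIso _ h))).mpr (.id _)
  | right_unitor f =>
    exact fun p => (congrArg PreservesCanonical (conjLeft_rightUnitor (appendIso p f))).mpr (.id _)
  | right_unitor_inv f =>
    exact fun p =>
      (congrArg PreservesCanonical (conjLeft_rightUnitor_inv (appendIso p f))).mpr (.id _)
  | left_unitor f =>
    exact fun p => (congrArg PreservesCanonical (conjLeft_leftUnitor (appendIso p f))).mpr (.id _)
  | left_unitor_inv f =>
    exact fun p =>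
      (congrArg PreservesCanonical (conjLeft_leftUnitor_inv (appendIso p f))).mpr (.id _)
  | of η =>
    intro p
    cases η with
    | map₂ η =>
      exact (congrArg PreservesCanonical ((Category.id_comp _).trans (Category.comp_id _))).mpr
        (PreservesCanonical.map₂ (F := free G) p η)
    | map_id =>
      exact (congrArg PreservesCanonical (congrArg (_ ≫ ·) (Category.comp_id _))).mpr
        (PreservesCanonical.mapId (F := free G) p)
    | map_comp f g =>
      exact (congrArg PreservesCanonical (conjLeft_paste_refl ((free G).mapComp f g))).mpr
        (PreservesCanonical.mapComp (F := free G) p f g)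

theorem canonical_normal {x y : OneCell b c} (p : Path a b) (η : cell x ⟶ cell y) :
    Canonical (free G) (append p x) (append p y) (normal p η) := by
  induction η using Quot.ind with
  | mk η => exact (preservesCanonical_normal η p).canonical

/-- For the empty prefix, normalization is whiskering with an identity 1-cell, up to composition
with isomorphisms. -/
theorem normal_injective {x y : OneCell b c} {η θ : cell x ⟶ cell y}
    (h : normal .nil η = normal .nil θ) : η = θ := by
  rw [normal, normal, conjLeft, conjLeft, Iso.cancel_iso_inv_left, Iso.cancel_iso_hom_right] at h
  exact (whiskerLeft_iff _ _).1 h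

end Normalization

end FreeLax

namespace FreeLax

open Quiver (Path)

/-! ### Faithfulness of supporting maps -/

section Support

variable {G : Type u} [Quiver.{v} G]

/-- The map `s` can only fold the positions `n` and `n + 1` into `n`, and nothing below `n` moves.
This is the effect of an absorption on terms. -/
theorem sumHom_fold {m n : ℕ} (f : Fin m →o Fin (n + 1)) (s : Fin (1 + 1) →o Fin 1)
    (i : Fin (m + 1)) :
    ((sumHom OrderHom.id s).comp ((castHom (Nat.add_assoc n 1 1)).comp
      (sumHom f (OrderHom.id : Fin 1 →o Fin 1))) i : ℕ) =
        if h : (i : ℕ) < m then (f ⟨i, h⟩ : ℕ) else n := by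
  have hs (j) : (s j : ℕ) = 0 := Nat.lt_one_iff.1 (s j).2
  have key : ((castHom (Nat.add_assoc n 1 1) (sumHom f (OrderHom.id : Fin 1 →o Fin 1) i)) : ℕ) =
      if h : (i : ℕ) < m then (f ⟨i, h⟩ : ℕ) else n + 1 + (i - m) := by
    rw [castHom_val, sumHom_val]
    rfl
  simp only [OrderHom.comp_coe, Function.comp_apply]
  rw [sumHom_val]
  split_ifs with h h' h'
  · rw [dif_pos h'] at key
    exact key
  · rw [dif_neg h'] at key
    omega
  · rw [dif_pos h'] at key
    have := (f ⟨i, h'⟩).2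
    omega
  · rw [hs, Nat.add_zero]

theorem supportHom_whiskerLeft {a b c : FreeLax G} (x : a ⟶ b) {y z : b ⟶ c} (η : y ⟶ z) :
    supportHom (x ◁ η) = sumHom OrderHom.id (supportHom η) := by
  induction η using Quot.ind
  rfl

theorem supportHom_whiskerRight {a b c : FreeLax G} {x y : a ⟶ b} (η : x ⟶ y) (z : b ⟶ c) :
    supportHom (η ▷ z) = sumHom (supportHom η) OrderHom.id := by
  induction η using Quot.ind
  rfl

variable {x : FreeLax G} {b c d : FreeBicategory G}

/-- The new term comes after all others, so the values do not change as natural numbers and the new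
last position is missed. -/
theorem supportHom_extend {X Y : x ⟶ (free G).obj b} (f : X ⟶ Y) {v : b ⟶ b} (θ : 𝟙 b ⟶ v)
    (i : Fin (terms X)) : (supportHom (extend f θ) i : ℕ) = supportHom f i := by
  unfold extend
  rw [supportHom_comp, supportHom_comp, supportHom_whiskerLeft]
  simp only [OrderHom.comp_coe, Function.comp_apply]
  refine (sumHom_val _ _ _).trans (dif_pos (supportHom f i).2)

theorem supportHom_absorb {X : x ⟶ (free G).obj b} {Y : x ⟶ (free G).obj c} {v : c ⟶ b}
    (f : X ⟶ Y ≫ (free G).map v) {w : b ⟶ d} {v' : c ⟶ d} (θ : v ≫ w ⟶ v')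
    (i : Fin (terms X + 1)) :
    (supportHom (absorb f θ) i : ℕ) =
      if h : (i : ℕ) < terms X then (supportHom f ⟨i, h⟩ : ℕ) else terms Y := by
  unfold absorb
  rw [supportHom_comp, supportHom_comp, supportHom_whiskerLeft, supportHom_whiskerRight]
  exact sumHom_fold (supportHom f) (supportHom ((free G).mapComp v w ≫ (free G).map₂ θ)) i

theorem supportHom_absorb_castSucc {X : x ⟶ (free G).obj b} {Y : x ⟶ (free G).obj c} {v : c ⟶ b}
    (f : X ⟶ Y ≫ (free G).map v) {w : b ⟶ d} {v' : c ⟶ d} (θ : v ≫ w ⟶ v') (i : Fin (terms X)) :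
    (supportHom (absorb f θ) i.castSucc : ℕ) = supportHom f i :=
  (supportHom_absorb f θ i.castSucc).trans (dif_pos i.2)

theorem supportHom_absorb_last {X : x ⟶ (free G).obj b} {Y : x ⟶ (free G).obj c} {v : c ⟶ b}
    (f : X ⟶ Y ≫ (free G).map v) {w : b ⟶ d} {v' : c ⟶ d} (θ : v ≫ w ⟶ v') :
    (supportHom (absorb f θ) (Fin.last (terms X)) : ℕ) = terms Y :=
  (supportHom_absorb f θ _).trans (dif_neg (lt_irrefl (terms X)))

theorem supportHom_eq_of_extend {X Y : x ⟶ (free G).obj b} {f g : X ⟶ Y} {v : b ⟶ b}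
    {θ θ' : 𝟙 b ⟶ v} (h : supportHom (extend f θ) = supportHom (extend g θ')) :
    supportHom f = supportHom g :=
  OrderHom.ext _ _ (funext fun i => Fin.ext ((supportHom_extend f θ i).symm.trans
    ((congrArg Fin.val (DFunLike.congr_fun h i)).trans (supportHom_extend g θ' i))))

/-- An absorption sends the last source term to the last target term, which an extension misses. -/
theorem supportHom_extend_ne_absorb {X : x ⟶ (free G).obj c} {Y : x ⟶ (free G).obj b} {w : c ⟶ b}
    (f : X ≫ (free G).map w ⟶ Y) {v : b ⟶ b} (θ : 𝟙 b ⟶ v) {v' : b ⟶ c}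
    (g : X ⟶ Y ≫ (free G).map v') (θ' : v' ≫ w ⟶ v) :
    supportHom (extend f θ) ≠ supportHom (absorb g θ') := fun h => by
  have := supportHom_extend f θ (Fin.last (terms X))
  rw [h, supportHom_absorb_last] at this
  exact absurd (supportHom f (Fin.last (terms X))).2 this.not_gt

theorem supportHom_eq_of_absorb {X : x ⟶ (free G).obj b} {Y : x ⟶ (free G).obj c} {v v₁ : c ⟶ b}
    {f : X ⟶ Y ≫ (free G).map v} {g : X ⟶ Y ≫ (free G).map v₁} {w : b ⟶ d} {v' : c ⟶ d}
    {θ : v ≫ w ⟶ v'} {θ' : v₁ ≫ w ⟶ v'} (h : supportHom (absorb f θ) = supportHom (absorb g θ')) :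
    supportHom f = supportHom g :=
  OrderHom.ext _ _ (funext fun i => Fin.ext ((supportHom_absorb_castSucc f θ i).symm.trans
    ((congrArg Fin.val (DFunLike.congr_fun h i.castSucc)).trans
      (supportHom_absorb_castSucc g θ' i))))

theorem supportHom_comp_map₂ {W : x ⟶ (free G).obj c} {X : x ⟶ (free G).obj b} {v v' : b ⟶ c}
    (f : W ⟶ X ≫ (free G).map v) (κ : v ⟶ v') :
    supportHom (f ≫ X ◁ (free G).map₂ κ) = supportHom f := by
  rw [supportHom_comp, supportHom_whiskerLeft]
  exact congrArg (OrderHom.comp · (supportHom f)) (sumHom_id _ _)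

/-- Canonical 2-cells between lists are determined by their supporting maps. -/
theorem eq_of_canonical {a b : FreeBicategory G} {p q : Path a b}
    {f g : listMap (free G) p ⟶ listMap (free G) q} (hf : Canonical (free G) p q f)
    (hg : Canonical (free G) p q g) (h : supportHom f = supportHom g) : f = g := by
  induction hf with
  | nil =>
    cases hg
    rfl
  | extend θ hf ih =>
    cases hg with
    | extend θ' hg =>
      -- The free bicategory is locally thin, by coherence for bicategories.
      obtain rfl : θ = θ' := Subsingleton.elim _ _
      rw [ih hg (supportHom_eq_of_extend h)]
    | absorb θ' hg => exact absurd h (supportHom_extend_ne_absorb _ θ _ θ')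
  | @absorb b c d p q v f w v' θ hf ih =>
    cases hg with
    | extend θ' hg => exact absurd h.symm (supportHom_extend_ne_absorb _ θ' _ θ)
    | @absorb _ _ _ _ _ v₁ g _ _ θ' hg =>
      -- The intermediate words `v` and `v₁` may differ, but cancelling the edges of `w` shows that
      -- they have the same path. So they are isomorphic, and the isomorphism can be moved into
      -- `θ'`.
      have hv : wordPath v₁ = wordPath v := by
        have := (wordPath_congr θ').trans (wordPath_congr θ).symm
        rw [wordPath_comp, wordPath_comp] at this
        exact Quiver.Path.comp_injective_left _ this
      obtain ⟨κ⟩ := nonempty_iso_of_wordPath_eq hv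
      have : f = g ≫ listMap (free G) q ◁ (free G).map₂ κ.hom := by
        exact ih (hg.map₂ _) ((supportHom_eq_of_absorb h).trans (supportHom_comp_map₂ g κ.hom).symm)
      rw [this, map₂_absorb]
      exact congrArg (absorb g) (Subsingleton.elim _ _)

/-- A 2-cell is determined by its supporting map. -/
theorem supportHom_injective {a b : FreeLax G} {x y : a ⟶ b} {η θ : x ⟶ y}
    (h : supportHom η = supportHom θ) : η = θ := by
  refine normal_injective (eq_of_canonical (canonical_normal .nil η) (canonical_normal .nil θ) ?_)
  have key : supportHom (listMap (free G) (.nil : Path (V := FreeBicategory G) a a) ◁ η) =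
      supportHom (listMap (free G) (.nil : Path (V := FreeBicategory G) a a) ◁ θ) := by
    exact (supportHom_whiskerLeft _ η).trans
      ((congrArg (sumHom OrderHom.id) h).trans (supportHom_whiskerLeft _ θ).symm)
  -- The two conjugates have the same outer isomorphisms and differ at most in the middle factor.
  simp only [normal, conjLeft, supportHom_comp]
  exact congrArg (fun k => OrderHom.comp (OrderHom.comp _ k) _) key

end Support

end FreeLax

/-! ### The underlying path of a 1-cell -/

section CellPath

variable {G : Type u} [Quiver.{v} G]

/-- The path of edges that underlies a formal 1-cell. -/
def cellPath : ∀ {a b : FreeBicategory G}, OneCell a b → @Quiver.Path G _ a b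
  | _, _, .app w => wordPath w
  | _, _, .unit a => @Quiver.Path.nil G _ a
  | _, _, .comp x y => (cellPath x).comp (cellPath y)

theorem length_cellPath : ∀ {a b : FreeBicategory G} (x : OneCell a b),
    (cellPath x).length = x.edges
  | _, _, .app w => length_wordPath w
  | _, _, .unit _ => rfl
  | _, _, .comp x y => (Quiver.Path.length_comp _ _).trans
      (congrArg₂ (· + ·) (length_cellPath x) (length_cellPath y))

theorem cellPath_eq₂ {gen : Generators G}
    (H : ∀ ⦃a b : FreeBicategory G⦄ ⦃x y : OneCell a b⦄, gen x y → cellPath x = cellPath y)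
    {a b : FreeBicategory G} {x y : OneCell a b} (η : Hom₂ gen x y) : cellPath x = cellPath y := by
  induction η with
  | of η => exact H η
  | id => rfl
  | vcomp _ _ h h' => exact h.trans h'
  | whisker_left f _ h => exact congrArg (cellPath f).comp h
  | whisker_right f _ h => exact congrArg (Quiver.Path.comp · (cellPath f)) h
  | associator => exact Quiver.Path.comp_assoc _ _ _
  | associator_inv => exact (Quiver.Path.comp_assoc _ _ _).symm
  | right_unitor => exact Quiver.Path.comp_nil _
  | right_unitor_inv => exact (Quiver.Path.comp_nil _).symm
  | left_unitor => exact Quiver.Path.nil_comp _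
  | left_unitor_inv => exact (Quiver.Path.nil_comp _).symm

theorem cellPath_eq {gen : Generators G} {R : Relations gen}
    (H : ∀ ⦃a b : FreeBicategory G⦄ ⦃x y : OneCell a b⦄, gen x y → cellPath x = cellPath y)
    {a b : Presented R} {x y : a ⟶ b} (η : x ⟶ y) : cellPath x = cellPath y := by
  induction η using Quot.ind with
  | mk η => exact cellPath_eq₂ H η

theorem cellPath_eq_of_component {gen : Generators G} {R : Relations gen}
    (H : ∀ ⦃a b : FreeBicategory G⦄ ⦃x y : OneCell a b⦄, gen x y → cellPath x = cellPath y)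
    {a b : Presented R} {W x : a ⟶ b}
    (h : (CategoryTheory.ConnectedComponents.mk W).objectProperty x) : cellPath W = cellPath x := by
  have hz : Zigzag x W := Quotient.exact h
  clear h
  induction hz with
  | refl => rfl
  | tail _ hs ih =>
    rcases hs with hs | hs
    · exact (cellPath_eq H hs.some).symm.trans ih
    · exact (cellPath_eq H hs.some).trans ih

theorem exists_path_split {V : Type u} [Quiver.{v} V] {a b : V} (p : Quiver.Path a b) (n : ℕ)
    (hn : n ≤ p.length) : ∃ (c : V) (q : Quiver.Path a c) (r : Quiver.Path c b),
      p = q.comp r ∧ q.length = n := by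
  induction p with
  | nil => exact ⟨a, .nil, .nil, rfl, (Nat.le_zero.1 hn).symm⟩
  | cons p e ih =>
    rcases Nat.lt_or_eq_of_le hn with h | h
    · obtain ⟨c, q, r, rfl, hq⟩ := ih (Nat.le_of_lt_succ h)
      exact ⟨c, q, r.cons e, rfl, hq⟩
    · exact ⟨_, p.cons e, .nil, rfl, h.symm⟩

/-- The edges of the shorter tail `r` are removed from the end of both sides; what is left of `s` is
`t`. -/
theorem exists_path_cancel {V : Type u} [Quiver.{v} V] {a b c d : V} (p : Quiver.Path a b)
    (q : Quiver.Path a c) (r : Quiver.Path b d) (s : Quiver.Path c d) (h : p.comp r = q.comp s)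
    (hl : r.length ≤ s.length) : ∃ t : Quiver.Path c b, p = q.comp t ∧ s = t.comp r := by
  induction r with
  | nil => exact ⟨s, h, rfl⟩
  | cons r e ih =>
    cases s with
    | nil => exact absurd hl (Nat.not_succ_le_zero _)
    | cons s e' =>
      rw [Quiver.Path.comp_cons, Quiver.Path.comp_cons] at h
      obtain rfl := Quiver.Path.obj_eq_of_cons_eq_cons h
      obtain rfl := eq_of_heq (Quiver.Path.hom_heq_of_cons_eq_cons h)
      obtain ⟨t, ht, rfl⟩ := ih s (eq_of_heq (Quiver.Path.heq_of_cons_eq_cons h))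
        (Nat.le_of_succ_le_succ hl)
      exact ⟨t, ht, rfl⟩

theorem nonempty_map₂_of_wordPath_eq {a b : FreeBicategory G} {f g : a ⟶ b}
    (h : wordPath f = wordPath g) : Nonempty (f ⟶ g) :=
  (nonempty_iso_of_wordPath_eq h).map Iso.hom

/-- The word `u` is what the last target term `v` must have contained before it absorbed `w`. -/
theorem exists_word_cancel {a b c d : FreeBicategory G} (p : @Quiver.Path G _ a b)
    (q : @Quiver.Path G _ a c) (w : b ⟶ d) (v : c ⟶ d)
    (h : p.comp (wordPath w) = q.comp (wordPath v)) (hl : wordEdges w ≤ wordEdges v) :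
    ∃ u : c ⟶ b, p = q.comp (wordPath u) ∧ wordEdges u ≤ wordEdges v ∧ Nonempty (u ≫ w ⟶ v) := by
  obtain ⟨t, hp, hv⟩ := exists_path_cancel (V := G) _ _ _ _ h
    (by rwa [length_wordPath, length_wordPath])
  have ht := wordPath_pathWord (a := c) (b := b) t
  refine ⟨pathWord t, hp.trans (congrArg q.comp ht.symm), ?_, nonempty_map₂_of_wordPath_eq ?_⟩
  · rw [← length_wordPath, ← length_wordPath, ht, hv]
    exact (Nat.le_add_right _ _).trans_eq (Quiver.Path.length_comp (V := G) t _).symm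
  · rw [wordPath_comp, ht, hv]

/-- A map between the sets of terms of two 1-cells is compatible if it commutes with the supporting
maps of the 1-cells. -/
def CompatibleTerms {gen : Generators G} {R : Relations gen} {a b c : Presented R} (x : a ⟶ b)
    (y : a ⟶ c) (g : Fin (terms x) →o Fin (terms y)) : Prop :=
  ∀ (i : Fin (edges x)) (j : Fin (edges y)), (i : ℕ) = j → g (support x i) = support y j

variable {gen : Generators G} {R : Relations gen} {a : Presented R} {b c d e : FreeBicategory G}

theorem support_comp_app (x : a ⟶ vertex R b) (w : b ⟶ c) (i : Fin (edges x + wordEdges w)) :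
    (support (x ≫ app R w) i : ℕ) =
      if h : (i : ℕ) < edges x then (support x ⟨i, h⟩ : ℕ) else terms x :=
  sumHom_val _ _ _

/-- A target term outside the image of a compatible map cannot contain edges, since each edge in it
would come from an edge of the source. -/
theorem CompatibleTerms.of_lt {x : a ⟶ vertex R b} {y : a ⟶ vertex R c} {w : c ⟶ b}
    {g : Fin (terms x) →o Fin (terms y + 1)} (h : CompatibleTerms x (y ≫ app R w) g)
    (he : edges x = edges y + wordEdges w) (hg : ∀ i, (g i : ℕ) < terms y) :
    wordEdges w = 0 ∧ CompatibleTerms x y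
      ⟨fun i => ⟨g i, hg i⟩, fun _ _ hij => g.monotone hij⟩ := by
  constructor
  · by_contra hw
    -- Counting from zero, position `edges y` is that of the first edge of `w`.
    have key := congrArg Fin.val
      (h ⟨edges y, by omega⟩ (⟨edges y, by omega⟩ : Fin (edges y + wordEdges w)) rfl)
    rw [support_comp_app, dif_neg (lt_irrefl _)] at key
    exact (hg _).ne key
  · intro i j hij
    have key := congrArg Fin.val (h i (j.castAdd (wordEdges w) : Fin (edges y + wordEdges w)) hij)
    rw [support_comp_app] at key
    exact Fin.ext (key.trans (dif_pos j.2))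

/-- All edges of `w` must lie in `v`. If `w` were longer, its first edge, at position `edges x`,
would lie in `y` on the target side, whereas `g` sends its term to the last one. -/
theorem CompatibleTerms.of_last {x : a ⟶ vertex R b} {y : a ⟶ vertex R c} {w : b ⟶ d} {v : c ⟶ d}
    {g : Fin (terms x + 1) →o Fin (terms y + 1)}
    (h : CompatibleTerms (x ≫ app R w) (y ≫ app R v) g)
    (he : edges x + wordEdges w = edges y + wordEdges v)
    (hg : (g (Fin.last _) : ℕ) = terms y) : wordEdges w ≤ wordEdges v := by
  by_contra hw
  have key := congrArg Fin.val (h (⟨edges x, by omega⟩ : Fin (edges x + wordEdges w))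
    (⟨edges x, by omega⟩ : Fin (edges y + wordEdges v)) rfl)
  have hlt : edges x < edges y := by omega
  rw [support_comp_app, dif_pos hlt] at key
  have hx : (support (x ≫ app R w) (⟨edges x, by omega⟩ : Fin (edges x + wordEdges w)) :
      Fin (terms x + 1)) = Fin.last _ :=
    Fin.ext ((support_comp_app x w _).trans (dif_neg (lt_irrefl _)))
  have := (support y ⟨edges x, hlt⟩).2
  rw [← key, ← hg] at this
  exact this.ne (congrArg (fun k => (g k : ℕ)) hx)

/-- Undoing an absorption removes the last source term and shortens the last target word; the
remaining edges keep their positions and their terms. -/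
theorem CompatibleTerms.castSucc {x : a ⟶ vertex R b} {y : a ⟶ vertex R c} {w : b ⟶ d} {v : c ⟶ d}
    {v' : c ⟶ b} {g : Fin (terms x + 1) →o Fin (terms y + 1)}
    (h : CompatibleTerms (x ≫ app R w) (y ≫ app R v) g)
    (he : wordEdges v' ≤ wordEdges v) :
    CompatibleTerms x (y ≫ app R v') (g.comp ⟨Fin.castSucc, fun _ _ hij => hij⟩) := by
  intro i (j : Fin (edges y + wordEdges v')) hij
  have hj := j.2
  have key := congrArg Fin.val (h (i.castAdd (wordEdges w) : Fin (edges x + wordEdges w))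
    (⟨j, hj.trans_le (Nat.add_le_add_left he _)⟩ :
      Fin (edges y + wordEdges v)) hij)
  have hx : (support (x ≫ app R w) (i.castAdd (wordEdges w) : Fin (edges x + wordEdges w)) :
      Fin (terms x + 1)) = (support x i).castSucc :=
    Fin.ext ((support_comp_app x w _).trans (dif_pos i.2))
  refine Fin.ext (Eq.trans ?_ (key.trans ?_))
  · exact (congrArg (fun k => (g k : ℕ)) hx).symm
  · exact (support_comp_app y v _).trans (support_comp_app y v' _).symm

end CellPath

namespace FreeLax

open Quiver (Path)

/-! ### Fullness of supporting maps -/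

section Full

variable {G : Type u} [Quiver.{v} G]

theorem cellPath_gen ⦃a b : FreeBicategory G⦄ ⦃x y : OneCell a b⦄ (η : Gen x y) :
    cellPath x = cellPath y := by
  cases η with
  | map₂ η => exact wordPath_congr η
  | map_id => rfl
  | map_comp f g => exact (wordPath_comp f g).symm

theorem edges_eq_of_cellPath_eq {a b : FreeLax G} {x y : a ⟶ b} (h : cellPath x = cellPath y) :
    edges x = edges y :=
  (length_cellPath x).symm.trans ((congrArg (Quiver.Path.length (V := G)) h).trans
    (length_cellPath y))

/-- The required 2-cell is built in canonical form. If `g` misses the last target term, this term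
has no edges and is created by `extend`. Otherwise `g` sends the last source term to it, and that
source term is treated by `absorb`. Either way one term fewer remains, so the total length of the
two lists controls the recursion. -/
theorem exists_list_supportHom_eq {a : FreeBicategory G} (n : ℕ) : ∀ {b : FreeBicategory G}
    (p q : Path a b) (_ : p.length + q.length < n)
    (_ : cellPath (listMap (free G) p) = cellPath (listMap (free G) q))
    (g : Fin (terms (listMap (free G) p)) →o Fin (terms (listMap (free G) q)))
    (_ : CompatibleTerms (listMap (free G) p) (listMap (free G) q) g),
    ∃ f : listMap (free G) p ⟶ listMap (free G) q, supportHom f = g := by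
  induction n with
  | zero => exact fun _ _ h => absurd h (Nat.not_lt_zero _)
  | succ n ih =>
    intro b p q hn hpath g h
    cases q with
    | nil =>
      cases p with
      | nil => exact ⟨𝟙 _, OrderHom.ext _ _ (funext fun i : Fin 0 => i.elim0)⟩
      | cons p w => exact (g (Fin.last _)).elim0
    | @cons c _ q v =>
      have hedges : edges (listMap (free G) p) = edges (listMap (free G) q) + wordEdges v :=
        edges_eq_of_cellPath_eq hpath
      by_cases hg : ∀ i, (g i : ℕ) < terms (listMap (free G) q)
      · obtain ⟨hv, hc⟩ := CompatibleTerms.of_lt h hedges hg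
        replace hv := (length_wordPath v).trans hv
        obtain rfl : c = b := Quiver.Path.eq_of_length_zero (V := G) _ hv
        replace hv := Quiver.Path.eq_nil_of_length_zero (V := G) _ hv
        -- A word without edges has the same path as the formal unit.
        obtain ⟨θ⟩ : Nonempty (𝟙 c ⟶ v) := nonempty_map₂_of_wordPath_eq hv.symm
        have hpath' : cellPath (listMap (free G) p) = cellPath (listMap (free G) q) :=
          hpath.trans (congrArg (Path.comp (V := G) (cellPath (listMap (free G) q))) hv)
        obtain ⟨f, hf⟩ := ih p q (Nat.lt_of_succ_lt_succ hn) hpath' _ hc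
        refine ⟨extend f θ, OrderHom.ext _ _ (funext fun i => Fin.ext ?_)⟩
        exact (supportHom_extend f θ i).trans (congrArg Fin.val (DFunLike.congr_fun hf i))
      · obtain ⟨i, hi⟩ := not_forall.1 hg
        cases p with
        | nil => exact (i : Fin 0).elim0
        | @cons d _ p w =>
          -- Some source term reaches the last target term, hence by monotonicity so does the last
          -- one.
          have hlast : (g (Fin.last (terms (listMap (free G) p))) : ℕ) =
              terms (listMap (free G) q) :=
            le_antisymm (Nat.le_of_lt_succ (g (Fin.last _)).2)
              ((not_lt.1 hi).trans (g.monotone (Fin.le_last (n := terms (listMap (free G) p)) i)))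
          have hle := CompatibleTerms.of_last h hedges hlast
          obtain ⟨u, hu, hle', ⟨θ⟩⟩ := exists_word_cancel _ _ w v hpath hle
          obtain ⟨f, hf⟩ := ih p (q.cons u) (by
            rw [Path.length_cons] at hn ⊢
            rw [Path.length_cons] at hn
            omega) hu _ (CompatibleTerms.castSucc h hle')
          refine ⟨absorb f θ, OrderHom.ext _ _ (funext fun i => Fin.ext ?_)⟩
          refine Fin.lastCases ?_ (fun i => ?_) i
          · exact (supportHom_absorb_last f θ).trans hlast.symm
          · exact (supportHom_absorb_castSucc f θ i).trans
              (congrArg Fin.val (DFunLike.congr_fun hf i))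

theorem CompatibleTerms.comp {a b : FreeLax G} {x x' y y' : a ⟶ b} (η : x' ⟶ x) (θ : y ⟶ y')
    {g : Fin (terms x) →o Fin (terms y)} (h : CompatibleTerms x y g) :
    CompatibleTerms x' y' ((supportHom θ).comp (g.comp (supportHom η))) := by
  intro i j hij
  have hη := DFunLike.congr_fun (supportHom_support η) i
  have hθ := DFunLike.congr_fun (supportHom_support θ)
    (Fin.cast (edges_eq edges_gen θ).symm j)
  refine Eq.trans ?_ hθ
  exact congrArg (supportHom θ) ((congrArg g hη).trans (h _ _ hij))

theorem exists_supportHom_eq_of_iso {a b : FreeLax G} {x x' y y' : a ⟶ b} (e : x ≅ x')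
    (e' : y ≅ y') {g : Fin (terms x) →o Fin (terms y)} (h : ∃ f : x' ⟶ y', supportHom f =
      (supportHom e'.hom).comp (g.comp (supportHom e.inv))) : ∃ η : x ⟶ y, supportHom η = g := by
  obtain ⟨f, hf⟩ := h
  refine ⟨e.hom ≫ f ≫ e'.inv, ?_⟩
  rw [supportHom_comp, supportHom_comp, hf]
  have hx : (supportHom e.inv).comp (supportHom e.hom) = OrderHom.id := by
    rw [← supportHom_comp, Iso.hom_inv_id]
    rfl
  have hy : (supportHom e'.inv).comp (supportHom e'.hom) = OrderHom.id := by
    rw [← supportHom_comp, Iso.hom_inv_id]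
    rfl
  change ((supportHom e'.inv).comp (supportHom e'.hom)).comp
    (g.comp ((supportHom e.inv).comp (supportHom e.hom))) = g
  rw [hx, hy]
  rfl

/-- Every compatible map between the terms of two parallel 1-cells with the same underlying path is
the supporting map of a 2-cell. -/
theorem exists_supportHom_eq {a b : FreeLax G} {x y : a ⟶ b} (hpath : cellPath x = cellPath y)
    (g : Fin (terms x) →o Fin (terms y)) (h : CompatibleTerms x y g) :
    ∃ η : x ⟶ y, supportHom η = g := by
  -- Each 1-cell is isomorphic to the list of its terms, and isomorphisms transport both
  -- compatibility and the 2-cell that realizes `g`.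
  let e (z : a ⟶ b) : z ≅ listMap (free G) (append (.nil : Path (V := FreeBicategory G) a a) z) :=
    (λ_ z).symm ≪≫ appendIso (.nil : Path (V := FreeBicategory G) a a) z
  exact exists_supportHom_eq_of_iso (e x) (e y) (exists_list_supportHom_eq _ _ _
    (Nat.lt_succ_self _) ((cellPath_eq cellPath_gen (e x).inv).trans
      (hpath.trans (cellPath_eq cellPath_gen (e y).hom))) _
    (CompatibleTerms.comp (e x).inv (e y).hom h))

/-- Unit maps and composition maps collapse all terms and formal units into a single term. -/
theorem nonempty_hom_app : ∀ {a b : FreeBicategory G} (x : OneCell a b),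
    ∃ (w : a ⟶ b), Nonempty (cell x ⟶ (free G).map w)
  | _, _, .app w => ⟨w, ⟨𝟙 ((free G).map w)⟩⟩
  | _, _, .unit a => ⟨𝟙 a, ⟨(free G).mapId a⟩⟩
  | _, _, .comp x y => by
    obtain ⟨w, ⟨η⟩⟩ := nonempty_hom_app x
    obtain ⟨w', ⟨θ⟩⟩ := nonempty_hom_app y
    exact ⟨w ≫ w', ⟨η ▷ cell y ≫ (free G).map w ◁ θ ≫ (free G).mapComp w w'⟩⟩

/-- Two 1-cells with the same underlying path are connected. -/
theorem zigzag_of_cellPath_eq {a b : FreeLax G} {x y : a ⟶ b} (h : cellPath x = cellPath y) :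
    Zigzag x y := by
  obtain ⟨w, ⟨η⟩⟩ := nonempty_hom_app (G := G) x
  obtain ⟨w', ⟨θ⟩⟩ := nonempty_hom_app (G := G) y
  have hw : wordPath w = wordPath w' :=
    (cellPath_eq cellPath_gen η).symm.trans (h.trans (cellPath_eq cellPath_gen θ))
  obtain ⟨κ⟩ := nonempty_map₂_of_wordPath_eq hw
  exact (Zigzag.of_hom (η ≫ (free G).map₂ κ)).trans (Zigzag.of_inv θ)

end Full

end FreeLax

/-! ### Realization of monotone maps as supporting maps of 1-cells -/

section EssSurj

variable {G : Type u} [Quiver.{v} G]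

/-- By monotonicity, the positions with value below `k` form an initial segment; `m` is its length.
-/
theorem exists_cutoff {n k : ℕ} (g : Fin n →o Fin (k + 1)) :
    ∃ m ≤ n, ∀ i : Fin n, (i : ℕ) < m ↔ (g i : ℕ) < k := by
  classical
  have H : ∃ m, ∀ i : Fin n, (g i : ℕ) < k → (i : ℕ) < m := ⟨n, fun i _ => i.2⟩
  refine ⟨Nat.find H, Nat.find_min' H fun i _ => i.2, fun i => ⟨fun hi => ?_, Nat.find_spec H i⟩⟩
  by_contra hk
  refine Nat.find_min H hi fun j hj => ?_
  by_contra hij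
  exact hk (lt_of_le_of_lt (g.monotone (not_lt.1 hij)) hj)

/-- Every map of ordered sets from the edges of a path is the supporting map of a 1-cell. -/
theorem exists_oneCell (k : ℕ) : ∀ {a b : FreeBicategory G} (p : @Quiver.Path G _ a b)
    (g : Fin p.length →o Fin k), ∃ x : OneCell a b, x.terms = k ∧ cellPath x = p ∧
      ∀ (i : Fin x.edges) (j : Fin p.length), (i : ℕ) = j → (x.support i : ℕ) = g j := by
  induction k with
  | zero =>
    intro a b p g
    have hp : p.length = 0 := by
      by_contra hp
      exact (g ⟨0, Nat.pos_of_ne_zero hp⟩).elim0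
    obtain rfl : a = b := Quiver.Path.eq_of_length_zero (V := G) _ hp
    obtain rfl := Quiver.Path.eq_nil_of_length_zero (V := G) _ hp
    exact ⟨.unit a, rfl, rfl, fun i : Fin 0 => i.elim0⟩
  | succ k ih =>
    intro a b p g
    obtain ⟨m, hm, hg⟩ := exists_cutoff g
    -- The path is cut where `g` reaches its largest possible value `k`: `q` is distributed over the
    -- first `k` terms by induction, and `r`, possibly empty, becomes the last term.
    obtain ⟨c, q, r, rfl, rfl⟩ := exists_path_split p m hm
    obtain ⟨x, rfl, rfl, hx⟩ := ih (b := c) q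
      ⟨fun i => ⟨g (i.castLE hm), (hg _).1 i.2⟩, fun _ _ hij => g.monotone hij⟩
    refine ⟨x.comp (.app (pathWord (a := c) (b := b) r)), rfl,
      congrArg (cellPath x).comp (wordPath_pathWord (a := c) (b := b) r), fun i j hij => ?_⟩
    refine (sumHom_val _ _ i).trans ?_
    split_ifs with h
    · exact hx ⟨i, h⟩ ⟨i, h.trans_eq (length_cellPath x).symm⟩ rfl |>.trans
        (congrArg (fun k => (g k : ℕ)) (Fin.ext hij))
    · have hj : ¬ (g j : ℕ) < x.terms := fun hk =>
        h ((hij.trans_lt ((hg j).2 hk)).trans_eq (length_cellPath x))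
      exact le_antisymm (not_lt.1 hj) (Nat.le_of_lt_succ (g j).2)

theorem CompatibleTerms.of_comp_eq {gen : Generators G} {R : Relations gen} {a b c : Presented R}
    {x : a ⟶ b} {y : a ⟶ c} {g : Fin (terms x) →o Fin (terms y)} {n : ℕ} (hx : n = edges x)
    (hy : n = edges y)
    (h : g.comp ((support x).comp (castHom hx)) = (support y).comp (castHom hy)) :
    CompatibleTerms x y g := by
  intro i j hij
  refine Eq.trans ?_ (DFunLike.congr_fun h (Fin.cast hy.symm j))
  exact congrArg (fun i => g (support x i)) (Fin.ext hij)

theorem support_comp_castHom_eq {gen : Generators G} {R : Relations gen} {a b : Presented R}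
    {x W : a ⟶ b} {g : Fin (edges W) →o Fin (terms x)} (h : edges W = edges x)
    (hg : ∀ (i : Fin (edges x)) (j : Fin (cellPath W).length), (i : ℕ) = j →
      (support x i : ℕ) = g.comp (castHom (length_cellPath W)) j) :
    (support x).comp (castHom h) = g :=
  OrderHom.ext _ _ (funext fun i => Fin.ext
    (hg (Fin.cast h i) (Fin.cast (length_cellPath W).symm i) rfl))

end EssSurj

/-! ### Commuting diagrams -/

theorem lift_comp_map {J : Type w} [Quiver.{w'} J] {A : Type u₁} [Category.{v₁} A] {B : Type u₂}
    [Category.{v₂} B] (L : J ⥤q A) (F : A ⥤ B) {i j : J} (p : Quiver.Path i j) :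
    (Paths.lift (L ⋙q F.toPrefunctor)).map p = F.map ((Paths.lift L).map p) := by
  induction p with
  | nil => exact (F.map_id _).symm
  | cons p e ih => exact (congrArg (· ≫ F.map (L.map e)) ih).trans (F.map_comp _ _).symm

theorem commutes_comp {J : Type w} [Quiver.{w'} J] {A : Type u₁} [Category.{v₁} A] {B : Type u₂}
    [Category.{v₂} B] {L : J ⥤q A} (F : A ⥤ B) (h : Commutes L) :
    Commutes (L ⋙q F.toPrefunctor) := fun _ _ p q =>
  (lift_comp_map L F p).trans ((congrArg F.map (h p q)).trans (lift_comp_map L F q).symm)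

/-! ### Coherence in the lax case -/

namespace FreeLax

theorem commutes_of_expectedToCommute {C : Type u₁} [Bicategory.{w₁, v₁} C] {D : Type u₂}
    [Bicategory.{w₂, v₂} D] {F : LaxFunctor C D} {a b : C} {J : Type w} [Quiver.{w'} J]
    {X : J ⥤q (F.obj a ⟶ F.obj b)} (h : ExpectedToCommute F X) : Commutes X := by
  obtain ⟨L, rfl, hL⟩ := h
  exact commutes_comp _ fun _ _ p q => supportHom_injective (hL p q)

variable {G : Type u} [Quiver.{v} G]

theorem isEquivalence_supportFunctor {a b : FreeLax G} (W : a ⟶ b) :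
    (supportFunctor W).IsEquivalence where
  faithful := ⟨fun {x y η θ} h =>
    ObjectProperty.hom_ext _ (supportHom_injective (congrArg CommaMorphism.right h))⟩
  full := ⟨fun {x y} g => by
    obtain ⟨η, hη⟩ := exists_supportHom_eq (x := x.obj) (y := y.obj)
      ((cellPath_eq_of_component cellPath_gen x.property).symm.trans
        (cellPath_eq_of_component cellPath_gen y.property)) g.right
      (CompatibleTerms.of_comp_eq _ _ (Under.w g))
    exact ⟨ObjectProperty.homMk η, Under.UnderMorphism.ext hη⟩⟩
  essSurj := ⟨fun Y => by
    obtain ⟨⟨⟨⟩⟩, ⟨k⟩, g⟩ := Y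
    -- Giving `x` the same underlying path as `W` places it in the component of `W`. It has exactly
    -- `k` terms, so the identity serves as the isomorphism.
    obtain ⟨x, rfl, hp, hx⟩ := exists_oneCell k (cellPath W)
      (OrderHom.comp g (castHom (length_cellPath W)))
    refine ⟨⟨x, Quotient.sound (s := Zigzag.setoid _) (zigzag_of_cellPath_eq hp)⟩,
      ⟨Under.isoMk (Iso.refl _) ?_⟩⟩
    exact support_comp_castHom_eq _ hx⟩

end FreeLax

/-! ### Reversal of 2-cells -/

section Dual

variable {G : Type u} [Quiver.{v} G] {gen gen' : Generators G} {R : Relations gen}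
  {R' : Relations gen'}

variable (R') in
/-- A formal 1-cell as a 1-cell of a presented bicategory. -/
def cellOf {a b : FreeBicategory G} (x : OneCell a b) : vertex R' a ⟶ vertex R' b := x

variable (q : ∀ {a b : FreeBicategory G} {x y : OneCell a b}, gen x y → (cellOf R' y ⟶ cellOf R' x))

/-- The reversal of a formal composite of 2-cells, given the reversals of the generators. -/
def dualHom₂ : ∀ {a b : FreeBicategory G} {x y : OneCell a b},
    Hom₂ gen x y → (cellOf R' y ⟶ cellOf R' x)
  | _, _, _, _, .of η => q η
  | _, _, _, _, .id _ => 𝟙 _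
  | _, _, _, _, .vcomp η θ => dualHom₂ θ ≫ dualHom₂ η
  | _, _, _, _, .whisker_left f η => cellOf R' f ◁ dualHom₂ η
  | _, _, _, _, .whisker_right f η => dualHom₂ η ▷ cellOf R' f
  | _, _, _, _, .associator f g h => (α_ (cellOf R' f) (cellOf R' g) (cellOf R' h)).inv
  | _, _, _, _, .associator_inv f g h => (α_ (cellOf R' f) (cellOf R' g) (cellOf R' h)).hom
  | _, _, _, _, .right_unitor f => (ρ_ (cellOf R' f)).inv
  | _, _, _, _, .right_unitor_inv f => (ρ_ (cellOf R' f)).hom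
  | _, _, _, _, .left_unitor f => (λ_ (cellOf R' f)).inv
  | _, _, _, _, .left_unitor_inv f => (λ_ (cellOf R' f)).hom

/-- The bicategory axioms are stable under reversal of 2-cells: associators and unitors are
exchanged with their inverses, the interchange law is read backwards, and pentagon and triangle
become their inverse forms. Only the bracketing of composites needs adjustment. -/
theorem dualHom₂_congr
    (H : ∀ {a b : FreeBicategory G} {x y : OneCell a b} {η θ : Hom₂ gen x y},
      R η θ → dualHom₂ q η = dualHom₂ q θ)
    {a b : FreeBicategory G} {x y : OneCell a b} {η θ : Hom₂ gen x y} (h : Rel R η θ) :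
    dualHom₂ q η = dualHom₂ q θ := by
  induction h with
  | of h => exact H h
  | vcomp_right η _ _ _ ih => exact congrArg (· ≫ dualHom₂ q η) ih
  | vcomp_left _ _ θ _ ih => exact congrArg (dualHom₂ q θ ≫ ·) ih
  | id_comp => exact Category.comp_id _
  | comp_id => exact Category.id_comp _
  | assoc => exact (Category.assoc _ _ _).symm
  | whisker_left f _ _ _ _ _ ih => exact congrArg (cellOf R' f ◁ ·) ih
  | whisker_left_id => exact Bicategory.whiskerLeft_id _ _
  | whisker_left_comp => exact Bicategory.whiskerLeft_comp _ _ _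
  | id_whisker_left η =>
    have := Bicategory.id_whiskerLeft (dualHom₂ q η)
    rw [← Category.assoc] at this
    exact this
  | comp_whisker_left f g η =>
    have := Bicategory.comp_whiskerLeft (cellOf R' f) (cellOf R' g) (dualHom₂ q η)
    rw [← Category.assoc] at this
    exact this
  | whisker_right _ _ f _ _ _ ih => exact congrArg (· ▷ cellOf R' f) ih
  | id_whisker_right => exact Bicategory.id_whiskerRight _ _
  | comp_whisker_right => exact Bicategory.comp_whiskerRight _ _ _
  | whisker_right_id η =>
    have := Bicategory.whiskerRight_id (dualHom₂ q η)
    rw [← Category.assoc] at this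
    exact this
  | whisker_right_comp g h η =>
    have := Bicategory.whiskerRight_comp (dualHom₂ q η) (cellOf R' g) (cellOf R' h)
    rw [← Category.assoc] at this
    exact this
  | whisker_assoc f η h =>
    have := Bicategory.whisker_assoc (cellOf R' f) (dualHom₂ q η) (cellOf R' h)
    rw [← Category.assoc] at this
    exact this
  | whisker_exchange => exact (Bicategory.whisker_exchange _ _).symm
  | associator_hom_inv => exact Iso.hom_inv_id _
  | associator_inv_hom => exact Iso.inv_hom_id _
  | left_unitor_hom_inv => exact Iso.hom_inv_id _
  | left_unitor_inv_hom => exact Iso.inv_hom_id _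
  | right_unitor_hom_inv => exact Iso.hom_inv_id _
  | right_unitor_inv_hom => exact Iso.inv_hom_id _
  | pentagon => exact (Category.assoc _ _ _).trans (Bicategory.pentagon_inv _ _ _ _)
  | triangle => exact Bicategory.triangle_assoc_comp_left_inv _ _

/-- The reversal of a 2-cell. -/
def dualHom (H : ∀ {a b : FreeBicategory G} {x y : OneCell a b} {η θ : Hom₂ gen x y},
      R η θ → dualHom₂ q η = dualHom₂ q θ)
    {a b : FreeBicategory G} {x y : OneCell a b} (η : cellOf R x ⟶ cellOf R y) :
    cellOf R' y ⟶ cellOf R' x :=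
  Quot.lift (dualHom₂ q) (fun _ _ h => dualHom₂_congr q H h) η

section

variable (H : ∀ {a b : FreeBicategory G} {x y : OneCell a b} {η θ : Hom₂ gen x y},
  R η θ → dualHom₂ q η = dualHom₂ q θ) {a b c : FreeBicategory G}

theorem dualHom_comp {x y z : OneCell a b} (η : cellOf R x ⟶ cellOf R y)
    (θ : cellOf R y ⟶ cellOf R z) : dualHom q H (η ≫ θ) = dualHom q H θ ≫ dualHom q H η := by
  induction η using Quot.ind
  induction θ using Quot.ind
  rfl

theorem dualHom_whiskerLeft (f : OneCell a b) {x y : OneCell b c} (η : cellOf R x ⟶ cellOf R y) :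
    dualHom q H (x := f.comp x) (y := f.comp y) (cellOf R f ◁ η) = cellOf R' f ◁ dualHom q H η := by
  induction η using Quot.ind
  rfl

theorem dualHom_whiskerRight {x y : OneCell a b} (η : cellOf R x ⟶ cellOf R y) (f : OneCell b c) :
    dualHom q H (x := x.comp f) (y := y.comp f) (η ▷ cellOf R f) = dualHom q H η ▷ cellOf R' f := by
  induction η using Quot.ind
  rfl

end

/-- Reversing 2-cells twice is the identity if this holds for the generators. -/
theorem dualHom_dualHom
    {q' : ∀ {a b : FreeBicategory G} {x y : OneCell a b}, gen' x y → (cellOf R y ⟶ cellOf R x)}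
    (H : ∀ {a b : FreeBicategory G} {x y : OneCell a b} {η θ : Hom₂ gen x y},
      R η θ → dualHom₂ q η = dualHom₂ q θ)
    (H' : ∀ {a b : FreeBicategory G} {x y : OneCell a b} {η θ : Hom₂ gen' x y},
      R' η θ → dualHom₂ q' η = dualHom₂ q' θ)
    (hq : ∀ {a b : FreeBicategory G} {x y : OneCell a b} (η : gen x y),
      dualHom q' H' (q η) = Quot.mk (Rel R) (Hom₂.of η))
    {a b : FreeBicategory G} {x y : OneCell a b} (η : cellOf R x ⟶ cellOf R y) :
    dualHom q' H' (dualHom q H η) = η := by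
  have key : ∀ η : Hom₂ gen x y, dualHom q' H' (dualHom₂ q η) = Quot.mk (Rel R) η := by
    clear η
    intro η
    induction η with
    | of η => exact hq η
    | vcomp η θ h h' =>
      exact (dualHom_comp q' H' (dualHom₂ q θ) (dualHom₂ q η)).trans
        (congrArg₂ (fun η θ => CategoryStruct.comp η θ) h h')
    | whisker_left f η h =>
      exact (dualHom_whiskerLeft q' H' f (dualHom₂ q η)).trans (congrArg (cellOf R f ◁ ·) h)
    | whisker_right f η h =>
      exact (dualHom_whiskerRight q' H' (dualHom₂ q η) f).trans (congrArg (· ▷ cellOf R f) h)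
    | _ => rfl
  induction η using Quot.ind with
  | mk η => exact key η

end Dual

/-! ### Structure maps against inverse associators and unitors -/

section

variable {B : Type u₁} [Bicategory.{w₁, v₁} B] {D : Type u₂} [Bicategory.{w₂, v₂} D] {a b c d : B}

/-- The associativity axiom in terms of the inverse associator, bracketed to the left because
reversal turns right-nested composites into left-nested ones. The oplax lemmas below have the same
purpose. -/
theorem lax_map₂_associator_inv (F : LaxFunctor B D) (f : a ⟶ b) (g : b ⟶ c) (h : c ⟶ d) :
    (F.map f ◁ F.mapComp g h ≫ F.mapComp f (g ≫ h)) ≫ F.map₂ (α_ f g h).inv =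
      ((α_ (F.map f) (F.map g) (F.map h)).inv ≫ F.mapComp f g ▷ F.map h) ≫
        F.mapComp (f ≫ g) h := by
  simp only [Category.assoc]
  rw [F.mapComp_assoc_left, Iso.inv_hom_id_assoc]

variable (F : OplaxFunctor B D)

theorem oplax_map₂_associator_inv (f : a ⟶ b) (g : b ⟶ c) (h : c ⟶ d) :
    (F.map₂ (α_ f g h).inv ≫ F.mapComp (f ≫ g) h) ≫ F.mapComp f g ▷ F.map h =
      (F.mapComp f (g ≫ h) ≫ F.map f ◁ F.mapComp g h) ≫
        (α_ (F.map f) (F.map g) (F.map h)).inv := by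
  rw [F.mapComp_assoc_right]
  simp only [Category.assoc, Iso.hom_inv_id, Category.comp_id]

theorem oplax_map₂_leftUnitor_inv (f : a ⟶ b) :
    (F.map₂ (λ_ f).inv ≫ F.mapComp (𝟙 a) f) ≫ F.mapId a ▷ F.map f = (λ_ (F.map f)).inv := by
  rw [Category.assoc, F.mapComp_id_left, ← Category.assoc, ← F.map₂_comp, Iso.inv_hom_id,
    F.map₂_id, Category.id_comp]

theorem oplax_map₂_rightUnitor_inv (f : a ⟶ b) :
    (F.map₂ (ρ_ f).inv ≫ F.mapComp f (𝟙 b)) ≫ F.map f ◁ F.mapId b = (ρ_ (F.map f)).inv := by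
  rw [Category.assoc, F.mapComp_id_right, ← Category.assoc, ← F.map₂_comp, Iso.inv_hom_id,
    F.map₂_id, Category.id_comp]

end

/-! ### The free lax and oplax targets as local opposites -/

section FreeDual

variable {G : Type u} [Quiver.{v} G]

/-- The reversals of the generating 2-cells of the target of the free oplax functor. -/
noncomputable def oplaxGenDual : ∀ {a b : FreeBicategory G} {x y : OneCell a b},
    FreeOplax.Gen x y → (cellOf FreeLax.Law y ⟶ cellOf FreeLax.Law x)
  | _, _, _, _, .map₂ η => (FreeLax.free G).map₂ (wordInv η)
  | _, _, _, _, .map_id a => (FreeLax.free G).mapId a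
  | _, _, _, _, .map_comp f g => (FreeLax.free G).mapComp f g

/-- The reversals of the generating 2-cells of the target of the free lax functor. -/
noncomputable def laxGenDual : ∀ {a b : FreeBicategory G} {x y : OneCell a b},
    FreeLax.Gen x y → (cellOf FreeOplax.Law y ⟶ cellOf FreeOplax.Law x)
  | _, _, _, _, .map₂ η => (FreeOplax.free G).map₂ (wordInv η)
  | _, _, _, _, .map_id a => (FreeOplax.free G).mapId a
  | _, _, _, _, .map_comp f g => (FreeOplax.free G).mapComp f g

/-- Local thinness of the free bicategory makes the choice in `wordInv` irrelevant: it may be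
replaced by any parallel 2-cell, for instance by a composite or whiskering of chosen inverses. -/
theorem map₂_subsingleton_lax {a b : FreeBicategory G} {f g : a ⟶ b} (η θ : f ⟶ g) :
    (FreeLax.free G).map₂ η = (FreeLax.free G).map₂ θ := by
  rw [Subsingleton.elim η θ]

theorem map₂_subsingleton_oplax {a b : FreeBicategory G} {f g : a ⟶ b} (η θ : f ⟶ g) :
    (FreeOplax.free G).map₂ η = (FreeOplax.free G).map₂ θ := by
  rw [Subsingleton.elim η θ]

theorem oplaxGenDual_law {a b : FreeBicategory G} {x y : OneCell a b}
    {η θ : Hom₂ FreeOplax.Gen x y} (h : FreeOplax.Law η θ) :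
    dualHom₂ oplaxGenDual η = dualHom₂ oplaxGenDual θ := by
  cases h with
  | map₂_id f => exact (map₂_subsingleton_lax _ (𝟙 _)).trans ((FreeLax.free G).map₂_id _)
  | map₂_comp η θ =>
    exact (map₂_subsingleton_lax _ (wordInv θ ≫ wordInv η)).trans ((FreeLax.free G).map₂_comp _ _)
  | map_comp_naturality_left η g =>
    exact (congrArg (_ ≫ ·) (map₂_subsingleton_lax _ (wordInv η ▷ g))).trans
      ((FreeLax.free G).mapComp_naturality_left (wordInv η) g)
  | map_comp_naturality_right f η =>
    exact (congrArg (_ ≫ ·) (map₂_subsingleton_lax _ (f ◁ wordInv η))).trans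
      ((FreeLax.free G).mapComp_naturality_right f (wordInv η))
  | map₂_associator f g h =>
    exact (congrArg (_ ≫ ·) (map₂_subsingleton_lax _ (α_ f g h).inv)).trans
      (lax_map₂_associator_inv (FreeLax.free G) f g h)
  | map₂_left_unitor f =>
    exact (map₂_subsingleton_lax _ (λ_ f).inv).trans
      (((FreeLax.free G).map₂_leftUnitor f).trans (Category.assoc _ _ _).symm)
  | map₂_right_unitor f =>
    exact (map₂_subsingleton_lax _ (ρ_ f).inv).trans
      (((FreeLax.free G).map₂_rightUnitor f).trans (Category.assoc _ _ _).symm)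

theorem laxGenDual_law {a b : FreeBicategory G} {x y : OneCell a b}
    {η θ : Hom₂ FreeLax.Gen x y} (h : FreeLax.Law η θ) :
    dualHom₂ laxGenDual η = dualHom₂ laxGenDual θ := by
  cases h with
  | map₂_id f => exact (map₂_subsingleton_oplax _ (𝟙 _)).trans ((FreeOplax.free G).map₂_id _)
  | map₂_comp η θ =>
    exact (map₂_subsingleton_oplax _ (wordInv θ ≫ wordInv η)).trans
      ((FreeOplax.free G).map₂_comp _ _)
  | map_comp_naturality_left η g =>
    exact (congrArg (· ≫ _) (map₂_subsingleton_oplax _ (wordInv η ▷ g))).trans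
      ((FreeOplax.free G).mapComp_naturality_left (wordInv η) g)
  | map_comp_naturality_right f η =>
    exact (congrArg (· ≫ _) (map₂_subsingleton_oplax _ (f ◁ wordInv η))).trans
      ((FreeOplax.free G).mapComp_naturality_right f (wordInv η))
  | map₂_associator f g h =>
    exact (congrArg (fun η => (η ≫ _) ≫ _) (map₂_subsingleton_oplax _ (α_ f g h).inv)).trans
      (oplax_map₂_associator_inv (FreeOplax.free G) f g h)
  | map₂_left_unitor f =>
    exact (congrArg (fun η => (η ≫ _) ≫ _) (map₂_subsingleton_oplax _ (λ_ f).inv)).trans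
      (oplax_map₂_leftUnitor_inv (FreeOplax.free G) f)
  | map₂_right_unitor f =>
    exact (congrArg (fun η => (η ≫ _) ≫ _) (map₂_subsingleton_oplax _ (ρ_ f).inv)).trans
      (oplax_map₂_rightUnitor_inv (FreeOplax.free G) f)

/-- The reversal of 2-cells from the oplax to the lax case. -/
noncomputable def oplaxToLax {a b : FreeOplax G} {x y : a ⟶ b} (η : x ⟶ y) :
    cellOf FreeLax.Law y ⟶ cellOf FreeLax.Law x :=
  dualHom oplaxGenDual oplaxGenDual_law η

/-- The reversal of 2-cells from the lax to the oplax case. -/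
noncomputable def laxToOplax {a b : FreeLax G} {x y : a ⟶ b} (η : x ⟶ y) :
    cellOf FreeOplax.Law y ⟶ cellOf FreeOplax.Law x :=
  dualHom laxGenDual laxGenDual_law η

theorem laxToOplax_oplaxToLax {a b : FreeOplax G} {x y : a ⟶ b} (η : x ⟶ y) :
    laxToOplax (oplaxToLax η) = η :=
  dualHom_dualHom _ _ _ (fun η => by
    cases η with
    | map₂ η => exact map₂_subsingleton_oplax _ η
    | map_id => rfl
    | map_comp => rfl) η

theorem oplaxToLax_laxToOplax {a b : FreeLax G} {x y : a ⟶ b} (η : x ⟶ y) :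
    oplaxToLax (laxToOplax η) = η :=
  dualHom_dualHom _ _ _ (fun η => by
    cases η with
    | map₂ η => exact map₂_subsingleton_lax _ η
    | map_id => rfl
    | map_comp => rfl) η

/-- Oplax supporting maps already point against the 2-cell, so reversal matches the two definitions
clause by clause. -/
theorem supportHom_oplaxToLax {a b : FreeOplax G} {x y : a ⟶ b} (η : x ⟶ y) :
    FreeLax.supportHom (oplaxToLax η) = FreeOplax.supportHom η := by
  induction η using Quot.ind with
  | mk η =>
    induction η with
    | of η =>
      cases η with
      | map₂ => rfl
      | map_id => rfl
      | map_comp => rfl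
    | vcomp η θ h h' => exact (FreeLax.supportHom_comp _ _).trans (congrArg₂ OrderHom.comp h h')
    | whisker_left f η h =>
      exact (FreeLax.supportHom_whiskerLeft _ _).trans (congrArg (sumHom OrderHom.id) h)
    | whisker_right f η h =>
      exact (FreeLax.supportHom_whiskerRight _ _).trans (congrArg (sumHom · OrderHom.id) h)
    | _ => rfl

end FreeDual

/-! ### Coherence in the oplax case -/

namespace FreeOplax

variable {G : Type u} [Quiver.{v} G]

theorem supportHom_injective {a b : FreeOplax G} {x y : a ⟶ b} {η θ : x ⟶ y}
    (h : supportHom η = supportHom θ) : η = θ := by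
  rw [← supportHom_oplaxToLax, ← supportHom_oplaxToLax] at h
  rw [← laxToOplax_oplaxToLax η, ← laxToOplax_oplaxToLax θ, FreeLax.supportHom_injective h]

theorem exists_supportHom_eq {a b : FreeOplax G} {x y : a ⟶ b} (hpath : cellPath y = cellPath x)
    (g : Fin (terms y) →o Fin (terms x)) (h : CompatibleTerms y x g) :
    ∃ η : x ⟶ y, supportHom η = g := by
  obtain ⟨θ, hθ⟩ := FreeLax.exists_supportHom_eq (x := cellOf FreeLax.Law y)
    (y := cellOf FreeLax.Law x) hpath g h
  exact ⟨laxToOplax θ, (supportHom_oplaxToLax (laxToOplax θ)).symm.trans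
    ((congrArg FreeLax.supportHom (oplaxToLax_laxToOplax θ)).trans hθ)⟩

theorem cellPath_gen ⦃a b : FreeBicategory G⦄ ⦃x y : OneCell a b⦄ (η : Gen x y) :
    cellPath x = cellPath y := by
  cases η with
  | map₂ η => exact wordPath_congr η
  | map_id => rfl
  | map_comp f g => exact wordPath_comp f g

theorem zigzag_of_cellPath_eq {a b : FreeOplax G} {x y : a ⟶ b} (h : cellPath x = cellPath y) :
    Zigzag x y := by
  have hz := FreeLax.zigzag_of_cellPath_eq (x := cellOf FreeLax.Law x)
    (y := cellOf FreeLax.Law y) h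
  -- Reversal turns each step of a zigzag around, and a zigzag allows both directions.
  have hzag (z t : vertex FreeLax.Law a ⟶ vertex FreeLax.Law b) (h : Zag z t) :
      Zag (J := a ⟶ b) z t :=
    Or.symm (h.imp (fun ⟨η⟩ => ⟨laxToOplax η⟩) (fun ⟨η⟩ => ⟨laxToOplax η⟩))
  exact Relation.ReflTransGen.mono hzag _ _ hz

theorem isEquivalence_supportFunctor {a b : FreeOplax G} (W : a ⟶ b) :
    (supportFunctor W).IsEquivalence where
  faithful := ⟨fun {x y η θ} h => ObjectProperty.hom_ext _ (supportHom_injective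
    (congrArg (fun k => CommaMorphism.right (Quiver.Hom.unop k)) h))⟩
  full := ⟨fun {x y} g => by
    obtain ⟨η, hη⟩ := exists_supportHom_eq (x := x.obj) (y := y.obj)
      ((cellPath_eq_of_component cellPath_gen y.property).symm.trans
        (cellPath_eq_of_component cellPath_gen x.property)) g.unop.right
      (CompatibleTerms.of_comp_eq _ _ (Under.w g.unop))
    exact ⟨ObjectProperty.homMk η, Quiver.Hom.unop_inj (Under.UnderMorphism.ext hη)⟩⟩
  essSurj := ⟨fun Y => by
    obtain ⟨⟨⟨⟨⟩⟩, ⟨k⟩, g⟩⟩ := Y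
    obtain ⟨x, rfl, hp, hx⟩ := exists_oneCell k (cellPath W)
      (OrderHom.comp g (castHom (length_cellPath W)))
    refine ⟨⟨x, Quotient.sound (s := Zigzag.setoid _) (zigzag_of_cellPath_eq hp)⟩,
      ⟨Iso.op (Iso.symm ?_)⟩⟩
    refine Under.isoMk (Iso.refl _) ?_
    exact support_comp_castHom_eq _ hx⟩

theorem commutes_of_expectedToCommute {C : Type u₁} [Bicategory.{w₁, v₁} C] {D : Type u₂}
    [Bicategory.{w₂, v₂} D] {F : OplaxFunctor C D} {a b : C} {J : Type w} [Quiver.{w'} J]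
    {X : J ⥤q (F.obj a ⟶ F.obj b)} (h : ExpectedToCommute F X) : Commutes X := by
  obtain ⟨L, rfl, hL⟩ := h
  exact commutes_comp _ fun _ _ p q => supportHom_injective (hL p q)

end FreeOplax

end LaxCoherence
theorem mainTheorem3 :
    -- lax functors of bicategories
    (∀ (C : Type u₁) [Bicategory.{w₁, v₁} C] (D : Type u₂) [Bicategory.{w₂, v₂} D]
      (F : LaxFunctor C D) (a b : C) (J : Type w) [Quiver.{w'} J]
      (X : J ⥤q (F.obj a ⟶ F.obj b)),
      LaxCoherence.FreeLax.ExpectedToCommute F X → LaxCoherence.Commutes X) ∧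
    -- lax monoidal functors
    (∀ (C : Type u₁) [Category.{v₁} C] [MonoidalCategory C]
      (D : Type u₂) [Category.{v₂} D] [MonoidalCategory D]
      (F : C ⥤ D) [F.LaxMonoidal] (J : Type w) [Quiver.{w'} J] (X : J ⥤q D),
      LaxCoherence.LaxMonoidalExpectedToCommute F X → LaxCoherence.Commutes X) ∧
    -- the supporting set functors of the free lax functor on a graph
    (∀ (G : Type u) [Quiver.{v} G] (a b : LaxCoherence.FreeLax G) (W : a ⟶ b),
      (LaxCoherence.FreeLax.supportFunctor W).IsEquivalence) ∧
    -- oplax functors of bicategories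
    (∀ (C : Type u₁) [Bicategory.{w₁, v₁} C] (D : Type u₂) [Bicategory.{w₂, v₂} D]
      (F : OplaxFunctor C D) (a b : C) (J : Type w) [Quiver.{w'} J]
      (X : J ⥤q (F.obj a ⟶ F.obj b)),
      LaxCoherence.FreeOplax.ExpectedToCommute F X → LaxCoherence.Commutes X) ∧
    -- oplax monoidal functors
    (∀ (C : Type u₁) [Category.{v₁} C] [MonoidalCategory C]
      (D : Type u₂) [Category.{v₂} D] [MonoidalCategory D]
      (F : C ⥤ D) [F.OplaxMonoidal] (J : Type w) [Quiver.{w'} J] (X : J ⥤q D),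
      LaxCoherence.OplaxMonoidalExpectedToCommute F X → LaxCoherence.Commutes X) ∧
    -- the supporting set functors of the free oplax functor on a graph
    (∀ (G : Type u) [Quiver.{v} G] (a b : LaxCoherence.FreeOplax G) (W : a ⟶ b),
      (LaxCoherence.FreeOplax.supportFunctor W).IsEquivalence) := by
  refine ⟨?_, ?_, ?_, ?_, ?_, ?_⟩
  · exact fun C _ D _ F a b J _ X h => LaxCoherence.FreeLax.commutes_of_expectedToCommute h
  · exact fun C _ _ D _ _ F _ J _ X h =>
      LaxCoherence.FreeLax.commutes_of_expectedToCommute (F := LaxCoherence.laxOfMonoidal F) h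
  · exact fun G _ a b W => LaxCoherence.FreeLax.isEquivalence_supportFunctor W
  · exact fun C _ D _ F a b J _ X h => LaxCoherence.FreeOplax.commutes_of_expectedToCommute h
  · exact fun C _ _ D _ _ F _ J _ X h =>
      LaxCoherence.FreeOplax.commutes_of_expectedToCommute (F := LaxCoherence.oplaxOfMonoidal F) h
  · exact fun G _ a b W => LaxCoherence.FreeOplax.isEquivalence_supportFunctor W
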